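/- Let $k\ge 2$ be an integer and let $S\subseteq\mathbb N=\{0,1,2,\dots\}$ be $k$-automatic: there is a deterministic finite automaton with outputs in $\{0,1\}$ that, for every $n\in\mathbb N$, outputs $1$ if $n\in S$ and $0$ if $n\notin S$ after reading the base-$k$ expansion of $n$ from left to right (most significant digit first, no leading zeros; the expansion of $0$ is the empty word). Let $\pi_S(n)=\#\{j\in S: j<n\}$, and let $\overline d(S)=\limsup_{n\to\infty}\pi_S(n)/n$ and $\underline d(S)=\liminf_{n\to\infty}\pi_S(n)/n$ be the upper and lower densities of $S$. Then $\overline d(S)$ and $\underline d(S)$ are recursively computable rational numbers, and $\underline d(S)=1-\overline d(\mathbb N\setminus S)$. Here "recursively computable" means that they can be computed from the automaton: there are two computable (total recursive) functions $U$ and $L$, not depending on $k$ or $S$, such that for every $k\ge 2$, every $k$-automatic set $S$, and every automaton as above that generates $S$, the values of $U$ and $L$ on a finite description of the automaton ($k$, a numbering of its states, the initial state, the transition table and the table of outputs) are pairs $(p,q)$ of natural numbers with $q\ne 0$ whose quotients $p/q$ are $\overline d(S)$ and $\underline d(S)$, respectively. -/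

import Mathlib

/-- A deterministic (complete) automaton with output: input alphabet `α`, states `σ`, output
alphabet `Δ`. Finiteness of `α` and `σ` is required where automata are used. -/
structure DFAO (α σ Δ : Type*) where
  /-- the transition function -/
  step : σ → α → σ
  /-- the initial state -/
  start : σ
  /-- the output function -/
  out : σ → Δ

namespace DFAO

variable {α σ Δ : Type*}

/-- The output of the automaton on the word `w`, which is read from left to right. -/
def eval (M : DFAO α σ Δ) (w : List α) : Δ :=
  M.out (w.foldl M.step M.start)

end DFAO

/-- The base-`k` expansion `(n)_k` of `n`, most significant digit first, without leading zeros;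
the expansion of `0` is the empty word. -/
def baseExpansion (k : ℕ) (hk : 2 ≤ k) (n : ℕ) : List (Fin k) :=
  ((Nat.digits k n).attach.map fun d => ⟨d.1, Nat.digits_lt_base hk d.2⟩).reverse

/-- The automaton `M` generates the sequence `a`: on input `(n)_k` it outputs `a n`. -/
def DFAO.Generates {k : ℕ} (hk : 2 ≤ k) {σ Δ : Type*} (M : DFAO (Fin k) σ Δ) (a : ℕ → Δ) : Prop :=
  ∀ n, M.eval (baseExpansion k hk n) = a n

/-- `a` is a `k`-automatic sequence: some automaton with finitely many states generates it. -/
def IsAutomaticSeq (k : ℕ) (hk : 2 ≤ k) {Δ : Type*} (a : ℕ → Δ) : Prop :=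
  ∃ (σ : Type) (_ : Finite σ) (M : DFAO (Fin k) σ Δ), M.Generates hk a

open Classical in
/-- The characteristic function of `S`, with the two values written `true` (for 1) and `false`
(for 0). -/
noncomputable def charSeq (S : Set ℕ) : ℕ → Bool := fun n => decide (n ∈ S)

/-- `S` is a `k`-automatic set: its characteristic function is a `k`-automatic sequence. -/
def IsAutomaticSet (k : ℕ) (hk : 2 ≤ k) (S : Set ℕ) : Prop :=
  IsAutomaticSeq k hk (charSeq S)

/-- The number of elements of `S` that are less than `n`. -/
noncomputable def countBelow (S : Set ℕ) (n : ℕ) : ℕ := (S ∩ Set.Iio n).ncard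

/-- The upper density of `S`. The sequence takes values in `[0, 1]`, so this is a genuine limsup. -/
noncomputable def upperDensity (S : Set ℕ) : ℝ :=
  Filter.limsup (fun n : ℕ => (countBelow S n : ℝ) / (n : ℝ)) Filter.atTop

/-- The lower density of `S`. -/
noncomputable def lowerDensity (S : Set ℕ) : ℝ :=
  Filter.liminf (fun n : ℕ => (countBelow S n : ℝ) / (n : ℝ)) Filter.atTop

/-- Finite descriptions of automata, on which algorithms operate: the size `k` of the input
alphabet, the number of the initial state, the transition table (one row for each state, with one
entry for each input letter), and the list of outputs of the states. -/
abbrev DFAOCode : Type := ℕ × ℕ × List (List ℕ) × List Bool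

/-- The description of an automaton with input alphabet `Fin k` and outputs in `{0, 1}`, after its
states have been numbered by `e`. -/
def DFAO.code {k m : ℕ} {σ : Type*} (M : DFAO (Fin k) σ Bool) (e : Fin m ≃ σ) : DFAOCode :=
  (k, (e.symm M.start : ℕ),
    List.ofFn (fun i : Fin m => List.ofFn (fun d : Fin k => (e.symm (M.step (e i) d) : ℕ))),
    List.ofFn (fun i : Fin m => M.out (e i)))

open Filter Topology

/-! Let `q n` be the state after reading `n`, let `v` be the output as a 0/1 vector, and let `T` be
the averaging operator over the digits, which is a stochastic matrix. After passing to blocks of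
`(card σ)!` digits, 1 is the only eigenvalue of `T` on the unit circle. As the powers of `T` are
bounded, `v = f + (w - T w)` with `T f = f`, and `T ^ n (w - T w)` tends to 0. Hence the means of
`v` and of `f` along `q` have the same limsup (`tendsto_mean_zero`).

For harmonic `f`, the sums `∑ j < n, f (q j)` obey an exact recursion when a digit is appended to
`n` (`excess_mul_add`), so the limsup of their means is the value of an optimisation problem over
digits. Its Bellman operator is a contraction with fixed point `h` (`exists_value_function`), and
the cost `α` per position that makes the best total value 0 is the upper density
(`exists_isPotential`, `limsup_mean_eq_of_isPotential`). By the pigeonhole principle along optimal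
digits, `α` and `h` are rational (`IsPotential.exists_rat`).

After clearing denominators, `f`, `w`, `h` and `α` form a certificate made of natural numbers, whose
validity is a primitive recursive condition. A certificate always exists (`exists_isCertificate`),
and every certificate gives the right value (`IsCertificate.limsup_eq`), so an unbounded search
computes the upper density. The lower density follows by complementing the outputs. -/

namespace AutomaticDensity

/-! ### Averaging operators of automata. -/

variable {σ : Type*}

/-- The state that is reached from `i` after reading the last `t` base-`k` digits of `n`, most
significant digit first. -/
def readDigits (δ : σ → ℕ → σ) (k : ℕ) : ℕ → σ → ℕ → σ
  | 0, i, _ => i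
  | t + 1, i, n => δ (readDigits δ k t i (n / k)) (n % k)

/-- The averaging operator of an automaton with transitions `δ` over the digits `0, …, k - 1`. -/
def avgOp (𝕜 : Type*) [Field 𝕜] (δ : σ → ℕ → σ) (k : ℕ) : (σ → 𝕜) →ₗ[𝕜] (σ → 𝕜) where
  toFun x i := (k : 𝕜)⁻¹ * ∑ d ∈ Finset.range k, x (δ i d)
  map_add' x y := by
    ext i
    simp [Finset.sum_add_distrib, mul_add]
  map_smul' c x := by
    ext i
    simp [← Finset.mul_sum, mul_left_comm]

theorem avgOp_apply (𝕜 : Type*) [Field 𝕜] (δ : σ → ℕ → σ) (k : ℕ) (x : σ → 𝕜) (i : σ) :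
    avgOp 𝕜 δ k x i = (k : 𝕜)⁻¹ * ∑ d ∈ Finset.range k, x (δ i d) := rfl

theorem sum_range_mul_eq {M : Type*} [AddCommMonoid M] (g : ℕ → M) (N k : ℕ) :
    ∑ n ∈ Finset.range (N * k), g n =
      ∑ n ∈ Finset.range N, ∑ d ∈ Finset.range k, g (k * n + d) := by
  induction N with
  | zero => simp
  | succ N ih =>
    rw [Finset.sum_range_succ, ← ih, Nat.succ_mul, Finset.sum_range_add, mul_comm N k]

theorem avgOp_pow_apply (𝕜 : Type*) [Field 𝕜] (δ : σ → ℕ → σ) {k : ℕ}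
    (t : ℕ) (x : σ → 𝕜) (i : σ) :
    (avgOp 𝕜 δ k ^ t) x i =
      ((k ^ t : ℕ) : 𝕜)⁻¹ * ∑ n ∈ Finset.range (k ^ t), x (readDigits δ k t i n) := by
  induction t generalizing x with
  | zero => simp [readDigits]
  | succ t ih =>
    rw [pow_succ, Module.End.mul_apply, ih, pow_succ, sum_range_mul_eq]
    simp only [avgOp_apply, ← Finset.mul_sum, Nat.cast_mul, mul_inv, mul_assoc]
    congr 2
    refine Finset.sum_congr rfl fun n _ => Finset.sum_congr rfl fun d hd => ?_
    have hd := Finset.mem_range.1 hd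
    rw [readDigits, Nat.mul_add_div (by omega), Nat.div_eq_of_lt hd, Nat.mul_add_mod,
      Nat.mod_eq_of_lt hd, add_zero]

/-- Reading `p` digits at once replaces the operator by its `p`-th power. This is how roots of unity
other than 1 are removed from the spectrum. -/
theorem avgOp_readDigits (𝕜 : Type*) [Field 𝕜] (δ : σ → ℕ → σ) (k p : ℕ) :
    avgOp 𝕜 (readDigits δ k p) (k ^ p) = avgOp 𝕜 δ k ^ p := by
  ext x i
  simp [avgOp_pow_apply, avgOp_apply]

theorem avgOp_map {𝕜 𝕝 : Type*} [Field 𝕜] [Field 𝕝] (φ : 𝕜 →+* 𝕝) (δ : σ → ℕ → σ) (k : ℕ)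
    (x : σ → 𝕜) : avgOp 𝕝 δ k (fun i => φ (x i)) = fun i => φ (avgOp 𝕜 δ k x i) := by
  ext i
  simp [avgOp_apply]

theorem avgOp_pow_map {𝕜 𝕝 : Type*} [Field 𝕜] [Field 𝕝] (φ : 𝕜 →+* 𝕝) (δ : σ → ℕ → σ) (k t : ℕ)
    (x : σ → 𝕜) : (avgOp 𝕝 δ k ^ t) (fun i => φ (x i)) = fun i => φ ((avgOp 𝕜 δ k ^ t) x i) := by
  ext i
  simp [avgOp_pow_apply]

/-! ### Operators with bounded powers. -/

section Norm

variable [Fintype σ] {𝕜 : Type*} [NormedField 𝕜] (hn : ∀ n : ℕ, ‖(n : 𝕜)‖ = n)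
include hn

/-- Means do not increase the sup norm. The hypothesis `hn` allows both `ℚ`, where the splitting is
made in order to stay rational, and `ℂ`, where the spectrum lives. -/
theorem norm_avgOp_le (δ : σ → ℕ → σ) {k : ℕ} (hk : k ≠ 0) (x : σ → 𝕜) :
    ‖avgOp 𝕜 δ k x‖ ≤ ‖x‖ := by
  refine (pi_norm_le_iff_of_nonneg (norm_nonneg _)).2 fun i => ?_
  rw [avgOp_apply, norm_mul, norm_inv, hn, inv_mul_le_iff₀ (by positivity)]
  refine (norm_sum_le _ _).trans ((Finset.sum_le_sum fun d _ => norm_le_pi_norm x _).trans ?_)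
  simp

theorem norm_avgOp_pow_le (δ : σ → ℕ → σ) {k : ℕ} (hk : k ≠ 0) (t : ℕ) (x : σ → 𝕜) :
    ‖(avgOp 𝕜 δ k ^ t) x‖ ≤ ‖x‖ := by
  induction t with
  | zero => simp
  | succ t ih =>
    rw [pow_succ', Module.End.mul_apply]
    exact (norm_avgOp_le hn δ hk _).trans ih

end Norm

/-- The kernel and the range of `1 - T` are disjoint when the powers of `T` are bounded. -/
theorem eq_zero_of_fixed_of_eq_sub {𝕜 V : Type*} [NormedField 𝕜] (hn : ∀ n : ℕ, ‖(n : 𝕜)‖ = n)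
    [NormedAddCommGroup V] [NormedSpace 𝕜 V] (T : V →ₗ[𝕜] V) (hT : ∀ (n : ℕ) x, ‖(T ^ n) x‖ ≤ ‖x‖)
    {x y : V} (hx : T x = x) (hy : x = y - T y) : x = 0 := by
  -- Linear growth of `T ^ n y` contradicts boundedness unless `x = 0`.
  have key : ∀ n : ℕ, (T ^ n) y = y - (n : 𝕜) • x := by
    intro n
    induction n with
    | zero => simp
    | succ n ih =>
      rw [pow_succ', Module.End.mul_apply, ih, map_sub, map_smul, hx]
      have : T y = y - x := by rw [hy]; abel
      rw [this]
      push_cast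
      rw [add_smul, one_smul]
      abel
  have bound : ∀ n : ℕ, (n : ℝ) * ‖x‖ ≤ 2 * ‖y‖ := by
    intro n
    have h1 : (n : 𝕜) • x = y - (T ^ n) y := by rw [key]; abel
    have h2 := norm_smul (n : 𝕜) x
    rw [hn, h1] at h2
    have h3 := norm_sub_le y ((T ^ n) y)
    have h4 := hT n y
    linarith
  by_contra hne
  have hpos : 0 < ‖x‖ := norm_pos_iff.2 hne
  obtain ⟨n, hn⟩ := exists_nat_gt (2 * ‖y‖ / ‖x‖)
  rw [div_lt_iff₀ hpos] at hn
  exact absurd (bound n) (not_le.2 hn)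

/-- Kernel and range of `1 - T` are disjoint and have complementary dimensions, so they span. No
completeness is needed, so the lemma applies over `ℚ`. -/
theorem exists_fixed_add_sub {𝕜 V : Type*} [NormedField 𝕜] (hn : ∀ n : ℕ, ‖(n : 𝕜)‖ = n)
    [NormedAddCommGroup V] [NormedSpace 𝕜 V] [FiniteDimensional 𝕜 V] (T : V →ₗ[𝕜] V)
    (hT : ∀ (n : ℕ) x, ‖(T ^ n) x‖ ≤ ‖x‖) (v : V) :
    ∃ f w : V, T f = f ∧ v - f = w - T w := by
  have hdisj : Disjoint (LinearMap.ker (1 - T)) (LinearMap.range (1 - T)) := by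
    rw [Submodule.disjoint_def]
    rintro x hx ⟨y, hy⟩
    refine eq_zero_of_fixed_of_eq_sub hn T hT (x := x) (y := y) ?_ ?_
    · have : x - T x = 0 := by simpa using hx
      exact (sub_eq_zero.1 this).symm
    · simpa using hy.symm
  have htop := Submodule.eq_top_of_disjoint _ _
    (by rw [add_comm]; exact ((1 - T).finrank_range_add_finrank_ker).ge) hdisj
  obtain ⟨f, hf, z, ⟨w, hw⟩, hfz⟩ := Submodule.mem_sup.1 (htop ▸ Submodule.mem_top : v ∈ _)
  refine ⟨f, w, ?_, ?_⟩
  · have : f - T f = 0 := by simpa using hf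
    exact (sub_eq_zero.1 this).symm
  · rw [← hfz, ← hw]
    simp

/-- By Gelfand's formula, `‖a ^ n‖` is eventually below `r ^ n` for some `r < 1`. -/
theorem tendsto_pow_zero_of_spectrum_lt_one {A : Type*} [NormedRing A] [NormedAlgebra ℂ A]
    [CompleteSpace A] (a : A) (ha : ∀ z ∈ spectrum ℂ a, ‖z‖₊ < 1) :
    Tendsto (fun n => a ^ n) atTop (𝓝 0) := by
  have hrad : spectralRadius ℂ a < 1 := by
    -- The spectrum is empty when the algebra is trivial, which does occur: the range of `1 - T` may
    -- be zero.
    rcases (spectrum ℂ a).eq_empty_or_nonempty with h | h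
    · simp [spectralRadius, h]
    · rw [← ENNReal.coe_one]
      exact spectrum.spectralRadius_lt_of_forall_lt_of_nonempty h ha
  obtain ⟨r, hr1, hr2⟩ := exists_between hrad
  have h := (spectrum.pow_nnnorm_pow_one_div_tendsto_nhds_spectralRadius a).eventually_lt_const hr1
  lift r to NNReal using (hr2.trans ENNReal.one_lt_top).ne
  have hr : (r : ℝ) < 1 := by exact_mod_cast hr2
  refine squeeze_zero_norm' ?_ (tendsto_pow_atTop_nhds_zero_of_lt_one r.2 hr)
  filter_upwards [h, eventually_gt_atTop 0] with n hn hpos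
  rw [one_div] at hn
  have h2 := ENNReal.rpow_inv_lt_iff (x := (‖a ^ n‖₊ : ENNReal)) (y := r)
    (by exact_mod_cast hpos : (0 : ℝ) < n) |>.1 hn
  rw [ENNReal.rpow_natCast] at h2
  exact_mod_cast h2.le

theorem tendsto_pow_apply_zero_of_eigenvalue_lt_one {W : Type*} [NormedAddCommGroup W]
    [NormedSpace ℂ W] [FiniteDimensional ℂ W] (S : W →ₗ[ℂ] W)
    (hS : ∀ z, Module.End.HasEigenvalue S z → ‖z‖ < 1) (u : W) :
    Tendsto (fun n => (S ^ n) u) atTop (𝓝 0) := by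
  have : CompleteSpace W := FiniteDimensional.complete ℂ W
  let A : W →L[ℂ] W := LinearMap.toContinuousLinearMap S
  have hApow : ∀ (n : ℕ) (x : W), (A ^ n) x = (S ^ n) x := by
    intro n
    induction n with
    | zero => simp
    | succ n ih =>
      intro x
      rw [pow_succ', pow_succ', Module.End.mul_apply, ← ih]
      rfl
  have hlim := tendsto_pow_zero_of_spectrum_lt_one A fun z hz => by
    have h := AlgEquiv.spectrum_eq (Module.End.toContinuousLinearMap W : _ ≃ₐ[ℂ] _) S
    exact hS z (Module.End.hasEigenvalue_iff_mem_spectrum.2 (h ▸ hz))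
  have h2 : Tendsto (fun n => ‖A ^ n‖ * ‖u‖) atTop (𝓝 0) := by
    simpa using (tendsto_norm_zero.comp hlim).mul_const ‖u‖
  refine squeeze_zero_norm (fun n => ?_) h2
  rw [← hApow]
  exact (A ^ n).le_opNorm u

/-- If the powers of `T` are bounded and `1` is the only eigenvalue of `T` on the unit circle, then
`T ^ n (w - T w)` tends to `0`. -/
theorem tendsto_pow_sub_zero {V : Type*} [NormedAddCommGroup V] [NormedSpace ℂ V]
    [FiniteDimensional ℂ V] (T : V →ₗ[ℂ] V) (hT : ∀ (n : ℕ) x, ‖(T ^ n) x‖ ≤ ‖x‖)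
    (hper : ∀ (μ : ℂ) (x : V), T x = μ • x → x ≠ 0 → ‖μ‖ = 1 → μ = 1) (w : V) :
    Tendsto (fun n => (T ^ n) (w - T w)) atTop (𝓝 0) := by
  -- Restricting `T` to the range of `1 - T` removes the eigenvalue 1, because fixed vectors in this
  -- range vanish.
  have hinv : ∀ x ∈ LinearMap.range (1 - T), T x ∈ LinearMap.range (1 - T) := by
    rintro _ ⟨y, rfl⟩
    exact ⟨T y, by simp⟩
  let S := T.restrict hinv
  have hSpow : ∀ (n : ℕ) (x : LinearMap.range (1 - T)), ((S ^ n) x : V) = (T ^ n) x := by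
    intro n
    induction n with
    | zero => simp
    | succ n ih =>
      intro x
      rw [pow_succ', Module.End.mul_apply, LinearMap.coe_restrict_apply, ih, pow_succ',
        Module.End.mul_apply]
  have hlim := tendsto_pow_apply_zero_of_eigenvalue_lt_one S (fun z hz => ?_)
    ⟨w - T w, w, by simp⟩
  · exact ((continuous_subtype_val.tendsto _).comp hlim).congr fun n => hSpow n _
  obtain ⟨x, hx⟩ := hz.exists_hasEigenvector
  have hTx : T (x : V) = z • (x : V) := congrArg Subtype.val hx.apply_eq_smul
  have hx0 : (x : V) ≠ 0 := fun h => hx.2 (Subtype.ext h)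
  have hle : ‖z‖ ≤ 1 := by
    have := hT 1 (x : V)
    rw [pow_one, hTx, norm_smul] at this
    exact le_of_mul_le_mul_right (by simpa using this) (norm_pos_iff.2 hx0)
  refine lt_of_le_of_ne hle fun heq => hx0 ?_
  obtain ⟨y, hy⟩ := x.2
  exact eq_zero_of_fixed_of_eq_sub (𝕜 := ℂ) (by simp) T hT
    (by rw [hTx, hper z x hTx hx0 heq, one_smul]) (by simpa using hy.symm : (x : V) = y - T y)

/-! ### Peripheral spectrum of averaging operators. -/

/-- Eigenvalues of the averaging operator on the unit circle are roots of unity. -/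
theorem peripheral_pow_factorial_eq_one [Fintype σ] (δ : σ → ℕ → σ) {k : ℕ} (hk : k ≠ 0) {μ : ℂ}
    {x : σ → ℂ} (hx : avgOp ℂ δ k x = μ • x) (hx0 : x ≠ 0) (hμ : ‖μ‖ = 1) :
    μ ^ (Fintype.card σ).factorial = 1 := by
  have hpos : 0 < ‖x‖ := norm_pos_iff.2 hx0
  have hne : Nonempty σ := by
    by_contra h
    rw [not_nonempty_iff] at h
    exact hx0 (Subsingleton.elim _ _)
  obtain ⟨i₀, hi₀⟩ : ∃ i, ‖x i‖ = ‖x‖ := by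
    obtain ⟨i, -, hi⟩ := Finset.exists_max_image Finset.univ (fun i => ‖x i‖) Finset.univ_nonempty
    exact ⟨i, le_antisymm (norm_le_pi_norm x i)
      ((pi_norm_le_iff_of_nonneg (norm_nonneg _)).2 fun j => hi j (Finset.mem_univ _))⟩
  -- Strict convexity of the disc: a mean of points of modulus at most `‖x‖` has modulus `‖x‖` only
  -- if all the points coincide. This is tested by real inner products with the mean.
  have step : ∀ i, ‖x i‖ = ‖x‖ → x (δ i 0) = μ * x i := by
    intro i hi
    have hsum : ∑ d ∈ Finset.range k, x (δ i d) = k * (μ * x i) := by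
      have := congrFun hx i
      rw [avgOp_apply, Pi.smul_apply, smul_eq_mul] at this
      rw [← this, mul_inv_cancel_left₀ (by exact_mod_cast hk)]
    set a := μ * x i with ha
    have hna : ‖a‖ = ‖x‖ := by rw [ha, norm_mul, hμ, hi, one_mul]
    have hle : ∀ d ∈ Finset.range k, inner ℝ a (x (δ i d)) ≤ ‖x‖ ^ 2 := fun d _ => by
      refine (real_inner_le_norm _ _).trans ?_
      rw [hna, sq]
      exact mul_le_mul_of_nonneg_left (norm_le_pi_norm x _) (norm_nonneg _)
    have heq : ∑ d ∈ Finset.range k, inner ℝ a (x (δ i d)) = ∑ d ∈ Finset.range k, ‖x‖ ^ 2 := by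
      rw [← inner_sum, hsum, Finset.sum_const, Finset.card_range, ← nsmul_eq_mul, ← hna,
        ← real_inner_self_eq_norm_sq, ← Nat.cast_smul_eq_nsmul ℝ, inner_smul_right, nsmul_eq_mul]
    have h0 := (Finset.sum_eq_sum_iff_of_le hle).1 heq 0 (Finset.mem_range.2 (by omega))
    have h1 : ‖x (δ i 0) - a‖ ^ 2 ≤ 0 := by
      rw [norm_sub_sq_real, real_inner_comm, h0, hna]
      have := pow_le_pow_left₀ (norm_nonneg _) (norm_le_pi_norm x (δ i 0)) 2
      linarith
    have h2 : ‖x (δ i 0) - a‖ = 0 := by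
      have := sq_nonneg ‖x (δ i 0) - a‖
      exact pow_eq_zero_iff two_ne_zero |>.1 (le_antisymm h1 this)
    exact sub_eq_zero.1 (norm_eq_zero.1 h2)
  set s : σ → σ := fun i => δ i 0 with hs
  have iter : ∀ n, x (s^[n] i₀) = μ ^ n * x i₀ := by
    intro n
    induction n with
    | zero => simp
    | succ n ih =>
      rw [Function.iterate_succ_apply', hs, step _ (by rw [← hs, ih]; simp [hμ, hi₀]), ← hs, ih,
        pow_succ']
      ring
  have hx1 : x i₀ ≠ 0 := by rw [← norm_pos_iff, hi₀]; exact hpos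
  have hμ0 : μ ≠ 0 := by rw [← norm_pos_iff, hμ]; exact one_pos
  -- Reading zeros from `i₀` multiplies `x` by `μ` each time. A state repeats within `card σ` steps,
  -- so the order of `μ` is at most `card σ` and divides the factorial.
  obtain ⟨a, b, hab, he⟩ := Fintype.exists_ne_map_eq_of_card_lt
    (fun n : Fin (Fintype.card σ + 1) => s^[(n : ℕ)] i₀) (by simp)
  wlog hlt : a < b generalizing a b
  · exact this b a hab.symm he.symm (lt_of_le_of_ne (not_lt.1 hlt) hab.symm)
  have hp : μ ^ (a : ℕ) = μ ^ (b : ℕ) :=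
    mul_right_cancel₀ hx1 (by rw [← iter, ← iter]; exact congrArg x he)
  have hlt' : (a : ℕ) < b := hlt
  have h1 : μ ^ ((b : ℕ) - a) = 1 := by
    have := pow_sub_mul_pow μ hlt'.le
    rw [← hp] at this
    exact mul_right_cancel₀ (pow_ne_zero _ hμ0) (by rw [this, one_mul])
  obtain ⟨c, hc⟩ := Nat.dvd_factorial (m := (b : ℕ) - a) (n := Fintype.card σ) (by omega)
    (by have := b.2; omega)
  rw [hc, pow_mul, h1, one_pow]

/-- For the automaton that reads `(card σ)!` digits at a time, `1` is the only peripheral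
eigenvalue, so that `T ^ n (w - T w)` tends to `0`. -/
theorem tendsto_avgOp_pow_sub [Fintype σ] (δ : σ → ℕ → σ) {k : ℕ} (hk : k ≠ 0) (w : σ → ℂ) :
    Tendsto (fun n => ((avgOp ℂ δ k ^ (Fintype.card σ).factorial) ^ n)
      (w - (avgOp ℂ δ k ^ (Fintype.card σ).factorial) w)) atTop (𝓝 0) := by
  set p := (Fintype.card σ).factorial
  have hp : 0 < p := Nat.factorial_pos _
  refine tendsto_pow_sub_zero _ (fun n x => ?_) (fun μ x hx hx0 hμ => ?_) w
  · rw [← pow_mul]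
    exact norm_avgOp_pow_le (by simp) δ hk _ x
  -- By spectral mapping, `μ` is the `p`-th power of a peripheral eigenvalue of the original
  -- operator.
  · have hmem : μ ∈ spectrum ℂ (avgOp ℂ δ k ^ p) :=
      Module.End.hasEigenvalue_iff_mem_spectrum.1
        (Module.End.hasEigenvalue_of_hasEigenvector ⟨Module.End.mem_eigenspace_iff.2 hx, hx0⟩)
    rw [spectrum.map_pow_of_pos _ hp] at hmem
    obtain ⟨l, hl, rfl⟩ := hmem
    obtain ⟨y, hy⟩ := (Module.End.hasEigenvalue_iff_mem_spectrum.2 hl).exists_hasEigenvector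
    have hl1 : ‖l‖ = 1 := by
      simp only [norm_pow] at hμ
      exact (pow_eq_one_iff_of_nonneg (norm_nonneg _) hp.ne').1 hμ
    exact peripheral_pow_factorial_eq_one δ hk hy.apply_eq_smul hy.2 hl1

/-! ### The optimisation problem over digits. -/

/-- The value of reading the digit `d` in the state `i`, in the optimisation problem whose value
function `h` is and in which a position of length one costs `α`. -/
def bracket (δ : σ → ℕ → σ) (f : σ → ℝ) (α : ℝ) (h : σ → ℝ) (i : σ) (d : ℕ) : ℝ :=
  ∑ e ∈ Finset.range d, f (δ i e) - α * d + h (δ i d)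

/-- `h` is the value function of the problem to maximise `∑ j < n, f (q j) - α n`, suitably
normalised, and the best value over all positive `n` is `0`. -/
structure IsPotential (δ : σ → ℕ → σ) (k : ℕ) (s : σ) (f : σ → ℝ) (α : ℝ) (h : σ → ℝ) : Prop where
  nonneg : ∀ i, 0 ≤ h i
  le : ∀ i, ∀ d < k, bracket δ f α h i d ≤ k * h i
  exists_eq : ∀ i, ∃ d < k, bracket δ f α h i d = k * h i
  start_le : ∀ d < k, 1 ≤ d → bracket δ f α h s d ≤ 0
  start_exists_eq : ∃ d < k, 1 ≤ d ∧ bracket δ f α h s d = 0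

section Sequence

variable {δ : σ → ℕ → σ} {k : ℕ} {q : ℕ → σ}

/-- For a fixed vector `x` of the averaging operator, the sum over the first `N * k` positions is
exactly `k` times the sum over the first `N`. This is why `v` is replaced by its harmonic part. -/
theorem sum_range_mul_state (hk : 0 < k) (hq : ∀ N, ∀ d < k, q (k * N + d) = δ (q N) d)
    (x : σ → ℝ) (N : ℕ) :
    ∑ n ∈ Finset.range (N * k), x (q n) = k * ∑ n ∈ Finset.range N, avgOp ℝ δ k x (q n) := by
  rw [sum_range_mul_eq, Finset.mul_sum]
  refine Finset.sum_congr rfl fun n _ => ?_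
  rw [avgOp_apply, mul_inv_cancel_left₀ (by positivity)]
  exact Finset.sum_congr rfl fun d hd => by rw [hq n d (Finset.mem_range.1 hd)]

theorem sum_range_mul_pow_state (hk : 0 < k) (hq : ∀ N, ∀ d < k, q (k * N + d) = δ (q N) d)
    (t : ℕ) (x : σ → ℝ) (N : ℕ) :
    ∑ n ∈ Finset.range (N * k ^ t), x (q n) =
      k ^ t * ∑ n ∈ Finset.range N, (avgOp ℝ δ k ^ t) x (q n) := by
  induction t generalizing x with
  | zero => simp
  | succ t ih =>
    rw [pow_succ, ← mul_assoc, sum_range_mul_state hk hq, ih, pow_succ (avgOp ℝ δ k),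
      Module.End.mul_apply]
    ring

/-- If the iterated averages of `u` tend to `0`, then so do the means of `u` along `q`. -/
theorem tendsto_mean_zero [Fintype σ] (hk : 0 < k)
    (hq : ∀ N, ∀ d < k, q (k * N + d) = δ (q N) d) {u : σ → ℝ}
    (hu : Tendsto (fun t => (avgOp ℝ δ k ^ t) u) atTop (𝓝 0)) :
    Tendsto (fun n : ℕ => (∑ j ∈ Finset.range n, u (q j)) / n) atTop (𝓝 0) := by
  rw [Metric.tendsto_atTop]
  intro ε hε
  obtain ⟨t, ht⟩ := (Metric.tendsto_atTop.1 hu (ε / 2) (half_pos hε)).imp fun t h => h t le_rfl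
  rw [dist_zero_right] at ht
  set c := ‖(avgOp ℝ δ k ^ t) u‖ with hc
  -- The positions below `n` are cut into complete blocks of length `k ^ t`, which contribute
  -- iterated averages, and one incomplete block, which contributes at most `k ^ t * ‖u‖`.
  have bound : ∀ n : ℕ, |∑ j ∈ Finset.range n, u (q j)| ≤ n * c + k ^ t * ‖u‖ := by
    intro n
    have hkt : 0 < k ^ t := Nat.pow_pos hk
    have hn : n = n / k ^ t * k ^ t + n % k ^ t := (Nat.div_add_mod' n _).symm
    set N := n / k ^ t
    set r := n % k ^ t
    have hr : r < k ^ t := Nat.mod_lt _ hkt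
    rw [hn, Finset.sum_range_add, sum_range_mul_pow_state hk hq]
    have h1 : |∑ n ∈ Finset.range N, (avgOp ℝ δ k ^ t) u (q n)| ≤ N * c := by
      refine (Finset.abs_sum_le_sum_abs _ _).trans
        ((Finset.sum_le_sum fun d _ => norm_le_pi_norm ((avgOp ℝ δ k ^ t) u) _).trans ?_)
      simp [hc]
    have h2 : |∑ x ∈ Finset.range r, u (q (N * k ^ t + x))| ≤ r * ‖u‖ := by
      refine (Finset.abs_sum_le_sum_abs _ _).trans
        ((Finset.sum_le_sum fun d _ => norm_le_pi_norm u _).trans ?_)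
      simp
    refine (abs_add_le _ _).trans ?_
    rw [abs_mul, abs_of_nonneg (by positivity : (0 : ℝ) ≤ k ^ t)]
    have h3 : (k : ℝ) ^ t * |∑ n ∈ Finset.range N, (avgOp ℝ δ k ^ t) u (q n)| ≤ k ^ t * (N * c) :=
      mul_le_mul_of_nonneg_left h1 (by positivity)
    have h4 : (r : ℝ) * ‖u‖ ≤ k ^ t * ‖u‖ :=
      mul_le_mul_of_nonneg_right (by exact_mod_cast hr.le) (norm_nonneg _)
    have h5 : 0 ≤ (r : ℝ) * c := by positivity
    push_cast
    nlinarith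
  obtain ⟨n₀, hn₀⟩ := exists_nat_gt (k ^ t * ‖u‖ / (ε / 2))
  refine ⟨n₀ + 1, fun n hn => ?_⟩
  have hn1 : (n₀ : ℝ) + 1 ≤ n := by exact_mod_cast hn
  have hpos : (0 : ℝ) < n := by
    have : (0 : ℝ) ≤ n₀ := by positivity
    linarith
  rw [dist_zero_right, Real.norm_eq_abs, abs_div, abs_of_pos hpos, div_lt_iff₀ hpos]
  rw [div_lt_iff₀ (half_pos hε)] at hn₀
  have h1 := bound n
  have h2 : (n : ℝ) * c ≤ n * (ε / 2) := mul_le_mul_of_nonneg_left ht.le hpos.le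
  have h3 : (n₀ : ℝ) * (ε / 2) < n * (ε / 2) :=
    mul_lt_mul_of_pos_right (by linarith) (half_pos hε)
  linarith

/-- The normalised excess of `∑ j < n, f (q j)` over `α n`. -/
def excess (q : ℕ → σ) (f : σ → ℝ) (α : ℝ) (h : σ → ℝ) (n : ℕ) : ℝ :=
  ∑ j ∈ Finset.range n, f (q j) - α * n + h (q n)

theorem excess_mul_add (hk : 0 < k) (hq : ∀ N, ∀ d < k, q (k * N + d) = δ (q N) d)
    {f : σ → ℝ} (hf : avgOp ℝ δ k f = f) (α : ℝ) (h : σ → ℝ) (N : ℕ) {d : ℕ} (hd : d < k) :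
    excess q f α h (k * N + d) =
      k * (excess q f α h N - h (q N)) + bracket δ f α h (q N) d := by
  have h1 := sum_range_mul_state hk hq f N
  rw [hf] at h1
  have h2 : ∑ e ∈ Finset.range d, f (q (k * N + e)) = ∑ e ∈ Finset.range d, f (δ (q N) e) :=
    Finset.sum_congr rfl fun e he => by rw [hq N e ((Finset.mem_range.1 he).trans hd)]
  rw [excess, excess, bracket, Finset.sum_range_add, mul_comm k N, h1, ← mul_comm k N, h2,
    hq N d hd]
  push_cast
  ring

theorem excess_digit (hk : 0 < k) (hq : ∀ N, ∀ d < k, q (k * N + d) = δ (q N) d)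
    {f : σ → ℝ} (hf : avgOp ℝ δ k f = f) (α : ℝ) (h : σ → ℝ) {d : ℕ} (hd : d < k) :
    excess q f α h d = bracket δ f α h (q 0) d := by
  have := excess_mul_add hk hq hf α h 0 hd
  simpa [excess] using this

/-- Following optimal digits, the excess is multiplied by `k` in each step. -/
theorem exists_optimal_sequence (hk : 2 ≤ k) (hq : ∀ N, ∀ d < k, q (k * N + d) = δ (q N) d)
    {f : σ → ℝ} (hf : avgOp ℝ δ k f = f) {α : ℝ} {h : σ → ℝ}
    (hex : ∀ i, ∃ d < k, bracket δ f α h i d = k * h i) {d₀ : ℕ} (hd₀ : d₀ < k) (h1 : 1 ≤ d₀) :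
    ∃ n : ℕ → ℕ, StrictMono n ∧
      ∀ j, 1 ≤ n j ∧ excess q f α h (n j) = k ^ j * bracket δ f α h (q 0) d₀ := by
  choose g hg hgeq using hex
  let n : ℕ → ℕ := fun j => Nat.rec d₀ (fun _ m => k * m + g (q m)) j
  have hn : ∀ j, n (j + 1) = k * n j + g (q (n j)) := fun _ => rfl
  have hpos : ∀ j, 1 ≤ n j := by
    intro j
    induction j with
    | zero => exact h1
    | succ j ih => rw [hn]; nlinarith
  refine ⟨n, strictMono_nat_of_lt_succ fun j => ?_, fun j => ⟨hpos j, ?_⟩⟩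
  · have := hpos j
    rw [hn]
    nlinarith
  · induction j with
    | zero =>
      rw [pow_zero, one_mul]
      exact excess_digit (by omega) hq hf α h hd₀
    | succ j ih =>
      rw [hn, excess_mul_add (by omega) hq hf α h _ (hg _), hgeq, ih]
      ring

/-- By induction on the number of digits: the Bellman inequality `bracket ≤ k * h` turns the
recursion into `excess (k * N + d) ≤ k * excess N`. -/
theorem IsPotential.excess_nonpos {f h : σ → ℝ} {α : ℝ} (hk : 2 ≤ k)
    (hq : ∀ N, ∀ d < k, q (k * N + d) = δ (q N) d) (hf : avgOp ℝ δ k f = f)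
    (hp : IsPotential δ k (q 0) f α h) {n : ℕ} (hn : 1 ≤ n) : excess q f α h n ≤ 0 := by
  induction n using Nat.strong_induction_on with
  | _ n ih =>
    have hd : n % k < k := Nat.mod_lt _ (by omega)
    rcases Nat.eq_zero_or_pos (n / k) with h0 | h0
    · have hlt : n < k := by
        rcases Nat.div_eq_zero_iff.1 h0 with h | h <;> omega
      rw [excess_digit (by omega) hq hf α h hlt]
      exact hp.start_le n hlt hn
    · have h1 := ih (n / k) (Nat.div_lt_self hn (by omega)) h0
      have h2 := hp.le (q (n / k)) _ hd
      have h3 : (k : ℝ) * excess q f α h (n / k) ≤ 0 :=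
        mul_nonpos_of_nonneg_of_nonpos (by positivity) h1
      rw [← Nat.div_add_mod n k, excess_mul_add (by omega) hq hf α h _ hd]
      linarith

/-- Verification argument. Nonpositive excess and `h ≥ 0` give the upper bound. Along optimal digits
the excess is exactly 0, and the bounded term `h` disappears after division by `n`, which gives the
lower bound. -/
theorem limsup_mean_eq_of_isPotential [Fintype σ] (hk : 2 ≤ k)
    (hq : ∀ N, ∀ d < k, q (k * N + d) = δ (q N) d) {v f h : σ → ℝ} {α : ℝ}
    (hf : avgOp ℝ δ k f = f) (hlim : Tendsto (fun t => (avgOp ℝ δ k ^ t) (v - f)) atTop (𝓝 0))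
    (hp : IsPotential δ k (q 0) f α h) :
    limsup (fun n : ℕ => (∑ j ∈ Finset.range n, v (q j)) / (n : ℝ)) atTop = α := by
  have hsmall := tendsto_mean_zero (by omega) hq hlim
  simp only [Pi.sub_apply, Finset.sum_sub_distrib, sub_div] at hsmall
  have habs : ∀ n : ℕ, |(∑ j ∈ Finset.range n, v (q j)) / (n : ℝ)| ≤ ‖v‖ := by
    intro n
    rw [abs_div, Nat.abs_cast]
    refine div_le_of_le_mul₀ (Nat.cast_nonneg n) (norm_nonneg _) ?_
    refine (Finset.abs_sum_le_sum_abs _ _).trans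
      ((Finset.sum_le_sum fun d _ => norm_le_pi_norm v _).trans ?_)
    simp [mul_comm]
  have hbdd : IsBoundedUnder (· ≤ ·) atTop
      (fun n : ℕ => (∑ j ∈ Finset.range n, v (q j)) / (n : ℝ)) :=
    isBoundedUnder_of ⟨‖v‖, fun n => (abs_le.1 (habs n)).2⟩
  have hcobdd : IsCoboundedUnder (· ≤ ·) atTop
      (fun n : ℕ => (∑ j ∈ Finset.range n, v (q j)) / (n : ℝ)) :=
    (isBoundedUnder_of ⟨-‖v‖, fun n => (abs_le.1 (habs n)).1⟩ :
      IsBoundedUnder (· ≥ ·) atTop _).isCoboundedUnder_le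
  refine le_antisymm ?_ ?_
  · refine le_of_forall_pos_le_add fun ε hε => limsup_le_of_le hcobdd ?_
    filter_upwards [hsmall.eventually_lt_const hε, eventually_ge_atTop 1] with n hn hn1
    have h1 := hp.excess_nonpos hk hq hf hn1
    have h2 : (∑ j ∈ Finset.range n, f (q j)) / (n : ℝ) ≤ α := by
      rw [div_le_iff₀ (by exact_mod_cast hn1)]
      have := hp.nonneg (q n)
      rw [excess] at h1
      linarith
    linarith
  · refine le_of_forall_pos_le_add fun ε hε => ?_
    rw [← sub_le_iff_le_add]
    refine le_limsup_of_frequently_le ?_ hbdd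
    obtain ⟨d₀, hd₀, h1, h0⟩ := hp.start_exists_eq
    obtain ⟨n, hmono, hn⟩ := exists_optimal_sequence hk hq hf hp.exists_eq hd₀ h1
    have hev : ∀ᶠ m : ℕ in atTop, ‖h‖ / m < ε / 2 ∧
        -(ε / 2) < (∑ j ∈ Finset.range m, v (q j)) / (m : ℝ) -
          (∑ j ∈ Finset.range m, f (q j)) / (m : ℝ) :=
      ((tendsto_const_div_atTop_nhds_zero_nat ‖h‖).eventually_lt_const (half_pos hε)).and
        (hsmall.eventually_const_lt (by linarith))
    refine hmono.tendsto_atTop.frequently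
      ((hmono.tendsto_atTop.eventually hev).frequently.mono fun j hj => ?_)
    obtain ⟨hj1, hj2⟩ := hj
    obtain ⟨hpos, heq⟩ := hn j
    rw [h0, mul_zero, excess] at heq
    have hposR : (0 : ℝ) < n j := by exact_mod_cast hpos
    have h3 : (∑ i ∈ Finset.range (n j), f (q i)) / (n j : ℝ) = α - h (q (n j)) / n j := by
      rw [eq_sub_iff_add_eq, ← add_div, div_eq_iff hposR.ne']
      linarith
    have h4 : h (q (n j)) / n j ≤ ‖h‖ / n j :=
      div_le_div_of_nonneg_right ((le_abs_self _).trans (norm_le_pi_norm h _)) hposR.le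
    linarith

end Sequence

/-! ### Existence and rationality of the potential. -/

section Value

variable {δ : σ → ℕ → σ} {k : ℕ} {q : ℕ → σ}

/-- Dividing the Bellman equation by `k` gives a sup-norm contraction with factor `1 / k ≤ 1 / 2`;
`h` is its fixed point. -/
theorem exists_value_function [Fintype σ] (hk : 2 ≤ k) (f : σ → ℝ) (α : ℝ) :
    ∃ h : σ → ℝ, (∀ i, 0 ≤ h i) ∧ (∀ i, ∀ d < k, bracket δ f α h i d ≤ k * h i) ∧
      ∀ i, ∃ d < k, bracket δ f α h i d = k * h i := by
  have hne : (Finset.range k).Nonempty := Finset.nonempty_range_iff.2 (by omega)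
  have hk0 : (0 : ℝ) < k := by positivity
  have hk2 : (2 : ℝ) ≤ k := by exact_mod_cast hk
  let B : (σ → ℝ) → (σ → ℝ) := fun h i =>
    (Finset.range k).sup' hne (fun d => bracket δ f α h i d) / k
  have hle : ∀ (x y : σ → ℝ) i, B x i ≤ B y i + dist x y / k := by
    intro x y i
    rw [← add_div]
    refine div_le_div_of_nonneg_right (Finset.sup'_le _ _ fun d hd => ?_) hk0.le
    have h1 := Finset.le_sup' (fun d => bracket δ f α y i d) hd
    have h2 := (le_abs_self _).trans ((Real.dist_eq _ _).symm.le.trans (dist_le_pi_dist x y (δ i d)))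
    simp only [bracket] at h1 ⊢
    linarith
  have hB : ContractingWith (2⁻¹ : NNReal) B := by
    refine ⟨inv_lt_one_of_one_lt₀ one_lt_two, LipschitzWith.of_dist_le_mul fun x y => ?_⟩
    refine (dist_pi_le_iff (by positivity)).2 fun i => ?_
    have h1 := hle x y i
    have h2 := hle y x i
    rw [dist_comm y x] at h2
    have h3 : dist x y / k ≤ ((2⁻¹ : NNReal) : ℝ) * dist x y := by
      rw [NNReal.coe_inv, NNReal.coe_ofNat, inv_mul_eq_div]
      exact div_le_div_of_nonneg_left dist_nonneg two_pos hk2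
    rw [Real.dist_eq, abs_sub_le_iff]
    constructor <;> linarith
  set h := hB.fixedPoint B with hh
  have hfix : ∀ i, (Finset.range k).sup' hne (fun d => bracket δ f α h i d) = k * h i := by
    intro i
    have := congrFun hB.fixedPoint_isFixedPt i
    rw [← hh] at this
    rw [← this]
    exact (mul_div_cancel₀ _ hk0.ne').symm
  have hle : ∀ i, ∀ d < k, bracket δ f α h i d ≤ k * h i := fun i d hd => by
    rw [← hfix]
    exact Finset.le_sup' (fun d => bracket δ f α h i d) (Finset.mem_range.2 hd)
  refine ⟨h, fun i => ?_, hle, fun i => ?_⟩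
  -- The digit 0 has no cost, so at a minimum `k * h j ≥ h (δ j 0) ≥ h j`, whence `h j ≥ 0`.
  · obtain ⟨j, -, hj⟩ := Finset.exists_min_image Finset.univ h ⟨i, Finset.mem_univ i⟩
    have h1 := hle j 0 (by omega)
    have h2 := hj (δ j 0) (Finset.mem_univ _)
    have h3 := hj i (Finset.mem_univ _)
    simp only [bracket, Finset.range_zero, Finset.sum_empty, Nat.cast_zero, mul_zero, sub_zero,
      zero_add] at h1
    nlinarith
  · obtain ⟨d, hd, he⟩ := Finset.exists_mem_eq_sup' hne (fun d => bracket δ f α h i d)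
    exact ⟨d, Finset.mem_range.1 hd, by rw [← hfix, he]⟩

/-- Here `α` is the supremum of the means of `f` over all `n ≥ 1`. It remains to see that the value
`g` of the best nonzero first digit is 0. -/
theorem exists_isPotential [Fintype σ] (hk : 2 ≤ k)
    (hq : ∀ N, ∀ d < k, q (k * N + d) = δ (q N) d) {f : σ → ℝ} (hf : avgOp ℝ δ k f = f)
    (hf0 : ∀ i, 0 ≤ f i) : ∃ α : ℝ, ∃ h : σ → ℝ, 0 ≤ α ∧ IsPotential δ k (q 0) f α h := by
  set A : Set ℝ := {x | ∃ n : ℕ, 1 ≤ n ∧ x = (∑ j ∈ Finset.range n, f (q j)) / n} with hA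
  have hbdd : BddAbove A := by
    refine ⟨‖f‖, ?_⟩
    rintro _ ⟨n, hn, rfl⟩
    refine div_le_of_le_mul₀ (Nat.cast_nonneg n) (norm_nonneg _) ?_
    refine (Finset.sum_le_sum fun d _ =>
      (le_abs_self _).trans (norm_le_pi_norm f (q d))).trans ?_
    simp [mul_comm]
  have hAne : A.Nonempty := ⟨_, 1, le_rfl, rfl⟩
  set α := sSup A with hα
  have hle : ∀ n : ℕ, 1 ≤ n → ∑ j ∈ Finset.range n, f (q j) - α * n ≤ 0 := by
    intro n hn
    have := le_csSup hbdd ⟨n, hn, rfl⟩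
    rw [← hα, div_le_iff₀ (by exact_mod_cast hn)] at this
    linarith
  have hα0 : 0 ≤ α := by
    have := hle 1 le_rfl
    simp only [Finset.range_one, Finset.sum_singleton, Nat.cast_one, mul_one] at this
    linarith [hf0 (q 0)]
  obtain ⟨h, h0, hmax, heq⟩ := exists_value_function (δ := δ) hk f α
  obtain ⟨d₀, hd₀, hd₀max⟩ := Finset.exists_max_image (Finset.Ico 1 k)
    (fun d => bracket δ f α h (q 0) d) ⟨1, by simp; omega⟩
  obtain ⟨hd1, hdk⟩ := Finset.mem_Ico.1 hd₀
  set g := bracket δ f α h (q 0) d₀ with hg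
  have hk0 : (0 : ℝ) < k := by positivity
  have hk1 : (1 : ℝ) < k := by exact_mod_cast hk
  -- If `g > 0`, optimal digits produce the excess `k ^ j * g`, which outgrows `‖h‖`, although the
  -- sums without `h` are nonpositive by the choice of `α`.
  have hg1 : g ≤ 0 := by
    by_contra hpos
    rw [not_le] at hpos
    obtain ⟨n, -, hn⟩ := exists_optimal_sequence hk hq hf heq hdk hd1
    obtain ⟨j, hj⟩ := pow_unbounded_of_one_lt (‖h‖ / g) hk1
    rw [div_lt_iff₀ hpos, ← (hn j).2, excess] at hj
    have h1 := hle _ (hn j).1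
    have h2 := (le_abs_self _).trans (norm_le_pi_norm h (q (n j)))
    linarith
  have hg2 : 0 ≤ g := by
    by_contra hneg
    rw [not_le] at hneg
    -- If `g < 0`, the excess is negative at a linear rate, so `α + g / k` still bounds all means, a
    -- contradiction. The form `n + 1` survives the induction because `n + 1 ≤ k * (n / k + 1)`.
    have key : ∀ n : ℕ, 1 ≤ n → excess q f α h n ≤ g / k * (n + 1) := by
      intro n hn
      induction n using Nat.strong_induction_on with
      | _ n ih =>
        have hd : n % k < k := Nat.mod_lt _ (by omega)
        have hgk : g / k * k = g := div_mul_cancel₀ _ hk0.ne'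
        have hgk0 : g / k < 0 := div_neg_of_neg_of_pos hneg hk0
        rcases Nat.eq_zero_or_pos (n / k) with h0 | h0
        · have hlt : n < k := by
            rcases Nat.div_eq_zero_iff.1 h0 with h | h <;> omega
          rw [excess_digit (by omega) hq hf α h hlt]
          refine (hd₀max n (Finset.mem_Ico.2 ⟨hn, hlt⟩)).trans ?_
          have : (n : ℝ) + 1 ≤ k := by exact_mod_cast hlt
          nlinarith
        · have h1 := ih (n / k) (Nat.div_lt_self hn (by omega)) h0
          have h2 := hmax (q (n / k)) _ hd
          have h3 := mul_le_mul_of_nonneg_left h1 hk0.le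
          have h4 : (n : ℝ) + 1 ≤ k * (((n / k : ℕ) : ℝ) + 1) := by
            have : n + 1 ≤ k * (n / k + 1) := by
              have := Nat.div_add_mod n k
              rw [mul_add, mul_one]
              omega
            exact_mod_cast this
          have h5 := mul_le_mul_of_nonpos_left h4 hgk0.le
          have h6 : excess q f α h n ≤ k * excess q f α h (n / k) := by
            have : excess q f α h n = excess q f α h (k * (n / k) + n % k) := by
              rw [Nat.div_add_mod]
            rw [this, excess_mul_add (by omega) hq hf α h _ hd]
            linarith
          linarith
    have hgk0 : g / k < 0 := div_neg_of_neg_of_pos hneg hk0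
    have : α ≤ α + g / k := by
      refine csSup_le hAne ?_
      rintro _ ⟨n, hn, rfl⟩
      rw [div_le_iff₀ (by exact_mod_cast hn)]
      have h1 := key n hn
      have h2 := h0 (q n)
      rw [excess] at h1
      linarith
    linarith
  have hg0 : g = 0 := le_antisymm hg1 hg2
  refine ⟨α, h, hα0, h0, hmax, heq, fun d hd hd' => ?_, d₀, hdk, hd1, hg0⟩
  exact (hd₀max d (Finset.mem_Ico.2 ⟨hd', hd⟩)).trans hg1

theorem IsPotential.exists_rat [Finite σ] (hk : 2 ≤ k)
    (hq : ∀ N, ∀ d < k, q (k * N + d) = δ (q N) d) {f : σ → ℚ} {h : σ → ℝ} {α : ℝ}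
    (hf : avgOp ℝ δ k (fun i => (f i : ℝ)) = fun i => (f i : ℝ))
    (hp : IsPotential δ k (q 0) (fun i => (f i : ℝ)) α h) :
    (∃ a : ℚ, α = a) ∧ ∀ i, ∃ r : ℚ, h i = r := by
  have hα : ∃ a : ℚ, α = a := by
    obtain ⟨d₀, hd₀, h1, h0⟩ := hp.start_exists_eq
    obtain ⟨n, hmono, hn⟩ := exists_optimal_sequence hk hq hf hp.exists_eq hd₀ h1
    -- The excess vanishes at `n a` and `n b` and the states agree, so `h` cancels in the difference
    -- and a linear equation for `α` with rational coefficients is left.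
    obtain ⟨a, b, hab, he⟩ := Finite.exists_ne_map_eq_of_infinite (fun j => q (n j))
    have ha := (hn a).2
    have hb := (hn b).2
    rw [h0, mul_zero, excess] at ha hb
    rw [show q (n a) = q (n b) from he] at ha
    have hne : (n a : ℝ) - n b ≠ 0 := by
      rw [sub_ne_zero]
      exact_mod_cast hmono.injective.ne hab
    refine ⟨(∑ j ∈ Finset.range (n a), f (q j) - ∑ j ∈ Finset.range (n b), f (q j)) /
      (n a - n b), ?_⟩
    push_cast
    rw [eq_div_iff hne]
    linarith
  refine ⟨hα, ?_⟩
  obtain ⟨a, rfl⟩ := hα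
  choose g hg hgeq using hp.exists_eq
  have hstep : ∀ i, ∃ r : ℚ, (k : ℝ) * h i = r + h (δ i (g i)) := fun i =>
    ⟨∑ e ∈ Finset.range (g i), f (δ i e) - a * g i, by rw [← hgeq, bracket]; push_cast; rfl⟩
  -- Iterating `s` writes `k ^ n * h i` as a rational number plus `h (s^[n] i)`. Two times at which
  -- the orbit meets the same state give an equation that determines `h i`.
  set s : σ → σ := fun i => δ i (g i)
  have hiter : ∀ (n : ℕ) i, ∃ r : ℚ, (k : ℝ) ^ n * h i = r + h (s^[n] i) := by
    intro n i
    induction n with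
    | zero => exact ⟨0, by simp⟩
    | succ n ih =>
      obtain ⟨r, hr⟩ := ih
      obtain ⟨r', hr'⟩ := hstep (s^[n] i)
      refine ⟨k * r + r', ?_⟩
      rw [Function.iterate_succ_apply', pow_succ', mul_assoc, hr, mul_add, hr']
      push_cast
      ring
  intro i
  obtain ⟨m, n, hmn, he⟩ := Finite.exists_ne_map_eq_of_infinite (fun j : ℕ => s^[j] i)
  obtain ⟨r, hr⟩ := hiter m i
  obtain ⟨r', hr'⟩ := hiter n i
  rw [show s^[m] i = s^[n] i from he] at hr
  have hk1 : (1 : ℝ) < k := by exact_mod_cast hk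
  have hne : (k : ℝ) ^ m - (k : ℝ) ^ n ≠ 0 := by
    rw [sub_ne_zero]
    exact fun h => hmn ((pow_right_strictMono₀ hk1).injective h)
  refine ⟨(r - r') / (k ^ m - k ^ n), ?_⟩
  push_cast
  rw [eq_div_iff hne]
  linarith

/-! ### Certificates with natural entries. -/

theorem exists_common_denominator {ι : Type*} [Finite ι] (x : ι → ℚ) (hx : ∀ i, 0 ≤ x i) :
    ∃ Z : ℕ, 0 < Z ∧ ∃ X : ι → ℕ, ∀ i, x i = X i / Z := by
  cases nonempty_fintype ι
  refine ⟨∏ i, (x i).den, Finset.prod_pos fun i _ => (x i).den_pos,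
    fun i => (x i).num.toNat * ((∏ i, (x i).den) / (x i).den), fun i => ?_⟩
  obtain ⟨c, hc⟩ := Finset.dvd_prod_of_mem (fun i => (x i).den) (Finset.mem_univ i)
  have hpos : 0 < ∏ i, (x i).den := Finset.prod_pos fun i _ => (x i).den_pos
  have hd := (x i).den_pos
  rw [hc] at hpos
  have hc0 : 0 < c := pos_of_mul_pos_right hpos hd.le
  simp only [hc, Nat.mul_div_cancel_left _ hd]
  have hnum : (((x i).num.toNat : ℕ) : ℚ) = (x i).num := by
    exact_mod_cast congrArg (Int.cast : ℤ → ℚ) (Int.toNat_of_nonneg (Rat.num_nonneg.2 (hx i)))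
  have h1 : (c : ℚ) ≠ 0 := by positivity
  push_cast
  rw [hnum, mul_div_mul_right _ _ h1, Rat.num_div_den]

/-- A finite certificate, with natural entries, that the density of the automaton is `a / b`: the
functions `F / Z`, `W / Z` and `H / (Z * b)` are the limit frequencies, a solution of the Poisson
equation, and a potential. -/
structure IsCertificate (δ : σ → ℕ → σ) (k : ℕ) (s : σ) (v : σ → ℕ) (Z a b : ℕ)
    (F W H : σ → ℕ) : Prop where
  pos : 0 < Z ∧ 0 < b
  harmonic : ∀ i, k * F i = ∑ d ∈ Finset.range k, F (δ i d)
  poisson : ∀ i, k * Z * v i + ∑ d ∈ Finset.range k, W (δ i d) = k * F i + k * W i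
  le : ∀ i, ∀ d < k, b * ∑ e ∈ Finset.range d, F (δ i e) + H (δ i d) ≤ k * H i + a * Z * d
  exists_eq : ∀ i, ∃ d < k,
    b * ∑ e ∈ Finset.range d, F (δ i e) + H (δ i d) = k * H i + a * Z * d
  start_le : ∀ d < k, 1 ≤ d → b * ∑ e ∈ Finset.range d, F (δ s e) + H (δ s d) ≤ a * Z * d
  start_exists_eq : ∃ d < k, 1 ≤ d ∧
    b * ∑ e ∈ Finset.range d, F (δ s e) + H (δ s d) = a * Z * d

section Certificate

variable {s : σ} {v : σ → ℕ} {Z a b : ℕ} {F W H : σ → ℕ}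

theorem bracket_div (hZ : 0 < Z) (hb : 0 < b) (i : σ) (d : ℕ) :
    bracket δ (fun i => (F i : ℝ) / Z) ((a : ℝ) / b) (fun i => (H i : ℝ) / (Z * b)) i d =
      (((b * ∑ e ∈ Finset.range d, F (δ i e) + H (δ i d) : ℕ) : ℝ) - ((a * Z * d : ℕ) : ℝ)) /
        (Z * b) := by
  have h1 : (Z : ℝ) ≠ 0 := by positivity
  have h2 : (b : ℝ) ≠ 0 := by positivity
  rw [bracket, ← Finset.sum_div]
  push_cast
  field_simp
  ring

theorem isPotential_iff_of_nat (hZ : 0 < Z) (hb : 0 < b) :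
    IsPotential δ k s (fun i => (F i : ℝ) / Z) ((a : ℝ) / b) (fun i => (H i : ℝ) / (Z * b)) ↔
      (∀ i, ∀ d < k, b * ∑ e ∈ Finset.range d, F (δ i e) + H (δ i d) ≤ k * H i + a * Z * d) ∧
      (∀ i, ∃ d < k, b * ∑ e ∈ Finset.range d, F (δ i e) + H (δ i d) = k * H i + a * Z * d) ∧
      (∀ d < k, 1 ≤ d → b * ∑ e ∈ Finset.range d, F (δ s e) + H (δ s d) ≤ a * Z * d) ∧
      ∃ d < k, 1 ≤ d ∧ b * ∑ e ∈ Finset.range d, F (δ s e) + H (δ s d) = a * Z * d := by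
  have hpos : (0 : ℝ) < Z * b := by positivity
  have e1 : ∀ x y z : ℕ, ((x : ℝ) - (z : ℝ)) / (Z * b) ≤ k * ((y : ℝ) / (Z * b)) ↔
      x ≤ k * y + z := by
    intro x y z
    rw [← mul_div_assoc, div_le_div_iff_of_pos_right hpos, sub_le_iff_le_add]
    norm_cast
  have e2 : ∀ x y z : ℕ, ((x : ℝ) - (z : ℝ)) / (Z * b) = k * ((y : ℝ) / (Z * b)) ↔
      x = k * y + z := by
    intro x y z
    rw [← mul_div_assoc, div_left_inj' hpos.ne', sub_eq_iff_eq_add]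
    norm_cast
  have e3 : ∀ x z : ℕ, ((x : ℝ) - (z : ℝ)) / (Z * b) ≤ 0 ↔ x ≤ z := by
    intro x z
    rw [div_le_iff₀ hpos, zero_mul, sub_nonpos]
    norm_cast
  have e4 : ∀ x z : ℕ, ((x : ℝ) - (z : ℝ)) / (Z * b) = 0 ↔ x = z := by
    intro x z
    rw [div_eq_zero_iff, or_iff_left hpos.ne', sub_eq_zero]
    norm_cast
  constructor
  · rintro ⟨-, h1, h2, h3, h4⟩
    simp only [bracket_div hZ hb, e1, e2, e3, e4] at h1 h2 h3 h4
    exact ⟨h1, h2, h3, h4⟩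
  · rintro ⟨h1, h2, h3, h4⟩
    refine ⟨fun i => by positivity, ?_, ?_, ?_, ?_⟩ <;>
    simp only [bracket_div hZ hb, e1, e2, e3, e4] <;> assumption

/-- Soundness of certificates. -/
theorem IsCertificate.limsup_eq [Fintype σ] (hk : 2 ≤ k)
    (hq : ∀ N, ∀ d < k, q (k * N + d) = δ (q N) d)
    (hc : IsCertificate δ k (q 0) v Z a b F W H)
    (hlim : ∀ w : σ → ℂ, Tendsto (fun n => (avgOp ℂ δ k ^ n) (w - avgOp ℂ δ k w)) atTop (𝓝 0)) :
    limsup (fun n : ℕ => (∑ j ∈ Finset.range n, (v (q j) : ℝ)) / (n : ℝ)) atTop = (a : ℝ) / b := by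
  obtain ⟨hZ, hb⟩ := hc.pos
  have hk0 : (k : ℝ) ≠ 0 := by positivity
  have hZ0 : (Z : ℝ) ≠ 0 := by positivity
  have hpot := (isPotential_iff_of_nat hZ hb).2
    ⟨hc.le, hc.exists_eq, hc.start_le, hc.start_exists_eq⟩
  have hf : avgOp ℝ δ k (fun i => (F i : ℝ) / Z) = fun i => (F i : ℝ) / Z := by
    ext i
    rw [avgOp_apply, ← Finset.sum_div, ← Nat.cast_sum, ← hc.harmonic]
    push_cast
    field_simp
  have hu : (fun i => (v i : ℝ)) - (fun i => (F i : ℝ) / Z) =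
      (fun i => (W i : ℝ) / Z) - avgOp ℝ δ k (fun i => (W i : ℝ) / Z) := by
    ext i
    have h := congrArg (Nat.cast : ℕ → ℝ) (hc.poisson i)
    push_cast at h
    simp only [Pi.sub_apply]
    rw [avgOp_apply, ← Finset.sum_div]
    field_simp
    linarith
  refine limsup_mean_eq_of_isPotential (v := fun i => (v i : ℝ)) hk hq hf ?_ hpot
  rw [hu]
  set w : σ → ℝ := fun i => (W i : ℝ) / Z
  have h := hlim (fun i => (w i : ℂ))
  have hcast : ∀ n, (avgOp ℂ δ k ^ n) ((fun i => (w i : ℂ)) - avgOp ℂ δ k (fun i => (w i : ℂ))) =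
      fun i => (((avgOp ℝ δ k ^ n) (w - avgOp ℝ δ k w) i : ℝ) : ℂ) := by
    intro n
    have h1 := avgOp_map Complex.ofRealHom δ k w
    have h2 := avgOp_pow_map Complex.ofRealHom δ k n (w - avgOp ℝ δ k w)
    simp only [Complex.ofRealHom_eq_coe] at h1 h2
    rw [h1, ← h2]
    congr 1
    ext i
    simp
  refine tendsto_pi_nhds.2 fun i => ?_
  refine ((Complex.continuous_re.tendsto _).comp (tendsto_pi_nhds.1 h i)).congr fun n => ?_
  rw [Function.comp_apply, hcast, Complex.ofReal_re]

/-- Completeness of certificates. -/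
theorem exists_isCertificate [Fintype σ] (hk : 2 ≤ k)
    (hq : ∀ N, ∀ d < k, q (k * N + d) = δ (q N) d) (v : σ → ℕ)
    (hlim : ∀ w : σ → ℂ, Tendsto (fun n => (avgOp ℂ δ k ^ n) (w - avgOp ℂ δ k w)) atTop (𝓝 0)) :
    ∃ (Z a b : ℕ) (F W H : σ → ℕ), IsCertificate δ k (q 0) v Z a b F W H := by
  have hkQ : (k : ℚ) ≠ 0 := by positivity
  have hnorm : ∀ n : ℕ, ‖(n : ℚ)‖ = n := fun n => by
    rw [← Rat.norm_cast_real]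
    simp
  obtain ⟨f, w₀, hf, hw₀⟩ := exists_fixed_add_sub hnorm (avgOp ℚ δ k)
    (norm_avgOp_pow_le hnorm δ (by omega)) (fun i => (v i : ℚ))
  -- `f` is the limit of the iterated averages of `v`, which are nonnegative.
  have hf0 : ∀ i, 0 ≤ f i := by
    intro i
    have hfpow : ∀ n, (avgOp ℚ δ k ^ n) f = f := by
      intro n
      induction n with
      | zero => rfl
      | succ n ih => rw [pow_succ, Module.End.mul_apply, hf, ih]
    have h1 := (tendsto_pi_nhds.1 (hlim (fun i => ((w₀ i : ℚ) : ℂ))) i)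
    have h2 : ∀ n, (avgOp ℂ δ k ^ n) ((fun i => ((w₀ i : ℚ) : ℂ)) -
        avgOp ℂ δ k (fun i => ((w₀ i : ℚ) : ℂ))) i =
        (((avgOp ℚ δ k ^ n) (fun i => (v i : ℚ)) i - f i : ℚ) : ℂ) := by
      intro n
      have h3 := avgOp_map (Rat.castHom ℂ) δ k w₀
      have h4 := avgOp_pow_map (Rat.castHom ℂ) δ k n ((fun i => (v i : ℚ)) - f)
      rw [show avgOp ℂ δ k (fun i => ((w₀ i : ℚ) : ℂ)) =
        fun i => ((avgOp ℚ δ k w₀ i : ℚ) : ℂ) from h3]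
      have h5 : ((fun i => ((w₀ i : ℚ) : ℂ)) - fun i => ((avgOp ℚ δ k w₀ i : ℚ) : ℂ)) =
          fun i => ((((fun i => (v i : ℚ)) - f) i : ℚ) : ℂ) := by
        rw [hw₀]
        ext i
        simp
      rw [h5]
      refine (congrFun h4 i).trans ?_
      rw [map_sub, hfpow]
      rfl
    simp only [h2, Pi.zero_apply] at h1
    have h3 : Tendsto (fun n => (((avgOp ℚ δ k ^ n) (fun i => (v i : ℚ)) i - f i : ℚ) : ℝ))
        atTop (𝓝 0) := by
      have := (Complex.continuous_re.tendsto _).comp h1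
      refine this.congr fun n => ?_
      simp only [Function.comp_apply]
      rw [← Complex.ofReal_ratCast, Complex.ofReal_re]
    have h4 : (0 : ℝ) ≤ 0 + f i := by
      refine ge_of_tendsto' (h3.add_const (f i : ℝ)) fun n => ?_
      push_cast
      rw [sub_add_cancel, avgOp_pow_apply]
      positivity
    exact_mod_cast (zero_add (f i : ℝ)) ▸ h4
  have hfR : avgOp ℝ δ k (fun i => (f i : ℝ)) = fun i => (f i : ℝ) := by
    have := avgOp_map (Rat.castHom ℝ) δ k f
    rw [hf] at this
    exact this
  obtain ⟨α, h, hα0, hpot⟩ := exists_isPotential hk hq hfR (fun i => by exact_mod_cast hf0 i)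
  obtain ⟨⟨α, rfl⟩, hr⟩ := hpot.exists_rat hk hq hfR
  choose h' hh' using hr
  obtain rfl : h = fun i => (h' i : ℝ) := funext hh'
  have hh0 : ∀ i, 0 ≤ h' i := fun i => by exact_mod_cast hpot.nonneg i
  -- Constants are fixed by the averaging operator, so this shift preserves the Poisson equation and
  -- makes natural entries possible.
  obtain ⟨C, hC⟩ : ∃ C : ℚ, ∀ i, 0 ≤ w₀ i + C := by
    obtain ⟨C, hC⟩ := (Set.finite_range w₀).bddBelow
    exact ⟨-C, fun i => by linarith [hC ⟨i, rfl⟩]⟩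
  obtain ⟨Z, hZ, X, hX⟩ := exists_common_denominator
    (Sum.elim f (Sum.elim (fun i => w₀ i + C) h'))
    (by rintro (i | i | i) <;> simp [hf0, hC, hh0])
  have hfX : ∀ i, f i = X (Sum.inl i) / Z := fun i => hX (Sum.inl i)
  have hwX : ∀ i, w₀ i = X (Sum.inr (Sum.inl i)) / Z - C := fun i =>
    eq_sub_of_add_eq (hX (Sum.inr (Sum.inl i)))
  have hhX : ∀ i, h' i = X (Sum.inr (Sum.inr i)) / Z := fun i => hX (Sum.inr (Sum.inr i))
  have hαX : α = (α.num.toNat : ℚ) / α.den := by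
    have : ((α.num.toNat : ℕ) : ℚ) = α.num := by
      exact_mod_cast congrArg (Int.cast : ℤ → ℚ)
        (Int.toNat_of_nonneg (Rat.num_nonneg.2 (by exact_mod_cast hα0)))
    rw [this, Rat.num_div_den]
  set a := α.num.toNat
  have hb : 0 < α.den := α.den_pos
  set b := α.den
  have hZQ : (Z : ℚ) ≠ 0 := by positivity
  have hZR : (Z : ℝ) ≠ 0 := by positivity
  have hbR : (b : ℝ) ≠ 0 := by positivity
  -- The potential has denominator `Z * b` in a certificate, hence the additional factor `b` in its
  -- numerator.
  have hpot' : IsPotential δ k (q 0) (fun i => (X (Sum.inl i) : ℝ) / Z) ((a : ℝ) / b)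
      (fun i => ((b * X (Sum.inr (Sum.inr i)) : ℕ) : ℝ) / (Z * b)) := by
    convert hpot using 1
    · ext i
      rw [hfX]
      push_cast
      rfl
    · rw [hαX]
      push_cast
      rfl
    · ext i
      rw [hhX]
      push_cast
      field_simp
  obtain ⟨h1, h2, h3, h4⟩ := (isPotential_iff_of_nat hZ hb).1 hpot'
  refine ⟨Z, a, b, fun i => X (Sum.inl i), fun i => X (Sum.inr (Sum.inl i)),
    fun i => b * X (Sum.inr (Sum.inr i)), ⟨hZ, hb⟩, fun i => ?_, fun i => ?_, h1, h2, h3, h4⟩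
  · have := congrFun hf i
    rw [avgOp_apply] at this
    simp only [hfX, ← Finset.sum_div] at this
    field_simp at this
    exact_mod_cast this.symm
  · have := congrFun hw₀ i
    simp only [Pi.sub_apply, avgOp_apply, hfX, hwX, Finset.sum_sub_distrib, ← Finset.sum_div,
      Finset.sum_const, Finset.card_range, nsmul_eq_mul] at this
    field_simp at this
    have h5 : (k : ℚ) * Z * v i + ∑ d ∈ Finset.range k, (X (Sum.inr (Sum.inl (δ i d))) : ℚ) =
      k * X (Sum.inl i) + k * X (Sum.inr (Sum.inl i)) := by linarith
    exact_mod_cast h5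

end Certificate

end Value

/-! ### Primitive recursive building blocks. -/

section Primrec

variable {A : Type*} [Primcodable A]

theorem primrec_sum_range {f : A → ℕ → ℕ} {n : A → ℕ} (hf : Primrec₂ f) (hn : Primrec n) :
    Primrec fun a => ∑ x ∈ Finset.range (n a), f a x := by
  refine (Primrec.nat_rec' (h := fun a p => p.2 + f a p.1) hn (Primrec.const 0)
    (Primrec.nat_add.comp (Primrec.snd.comp Primrec.snd)
      (hf.comp Primrec.fst (Primrec.fst.comp Primrec.snd)))).of_eq fun a => ?_
  induction n a with
  | zero => rfl
  | succ n ih => rw [Finset.sum_range_succ, ← ih]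

theorem primrec_pow {f g : A → ℕ} (hf : Primrec f) (hg : Primrec g) :
    Primrec fun a => f a ^ g a := by
  refine (Primrec.nat_rec' (h := fun a p => p.2 * f a) hg (Primrec.const 1)
    (Primrec.nat_mul.comp (Primrec.snd.comp Primrec.snd)
      (hf.comp Primrec.fst))).of_eq fun a => ?_
  induction g a with
  | zero => rfl
  | succ n ih => rw [pow_succ, ← ih]

theorem primrec_factorial {f : A → ℕ} (hf : Primrec f) : Primrec fun a => (f a).factorial := by
  refine (Primrec.nat_rec' (h := fun _ p => (p.1 + 1) * p.2) hf (Primrec.const 1)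
    (Primrec.nat_mul.comp (Primrec.succ.comp (Primrec.fst.comp Primrec.snd))
      (Primrec.snd.comp Primrec.snd))).of_eq fun a => ?_
  induction f a with
  | zero => rfl
  | succ n ih => rw [Nat.factorial_succ, ← ih]

theorem primrecPred_forall_lt {P : A → ℕ → Prop} {n : A → ℕ}
    (hP : PrimrecPred fun x : A × ℕ => P x.1 x.2) (hn : Primrec n) :
    PrimrecPred fun a => ∀ x < n a, P a x := by
  have hR : PrimrecRel fun (x : ℕ) (a : A) => P a x := hP.comp (Primrec.snd.pair Primrec.fst)
  exact (hR.forall_mem_list.comp (Primrec.list_range.comp hn) Primrec.id).of_eq (by simp)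

theorem primrecPred_exists_lt {P : A → ℕ → Prop} {n : A → ℕ}
    (hP : PrimrecPred fun x : A × ℕ => P x.1 x.2) (hn : Primrec n) :
    PrimrecPred fun a => ∃ x < n a, P a x := by
  have hR : PrimrecRel fun (x : ℕ) (a : A) => P a x := hP.comp (Primrec.snd.pair Primrec.fst)
  exact (hR.exists_mem_list.comp (Primrec.list_range.comp hn) Primrec.id).of_eq (by simp)

end Primrec

/-- `readDigits` changes its argument `n` in the recursion. The loop on the left keeps `n` as a
parameter and extracts the digits from the top, so that it fits `Primrec.nat_rec'`. -/
theorem readDigits_eq_rec {σ : Type*} (δ : σ → ℕ → σ) (k t : ℕ) (i : σ) (n : ℕ) :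
    Nat.rec (motive := fun _ => σ) i (fun j s => δ s (n / k ^ (t - (j + 1)) % k)) t =
      readDigits δ k t i n := by
  have key : ∀ j ≤ t, Nat.rec (motive := fun _ => σ) i
      (fun j s => δ s (n / k ^ (t - (j + 1)) % k)) j = readDigits δ k j i (n / k ^ (t - j)) := by
    intro j
    induction j with
    | zero => intro _; rfl
    | succ j ih =>
      intro hj
      rw [readDigits, Nat.div_div_eq_div_mul, ← pow_succ,
        show t - (j + 1) + 1 = t - j by omega, ← ih (by omega)]
  simpa using key t le_rfl

/-! ### Codes of automata and the test for certificates. -/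

/-- The state numbers of the automaton that is described by `c` are less than `codeSize c`; one
more state, with this number, serves as initial state and ignores leading zeros. -/
def codeSize (c : DFAOCode) : ℕ := c.2.2.2.length

/-- The row of the tables of `c` that is used in the state `i`. -/
def codeRow (c : DFAOCode) (i : ℕ) : ℕ := if i = codeSize c then c.2.1 else i

/-- The transition function of the code `c`, with default values where `c` is not well-formed. -/
def codeStep (c : DFAOCode) (i d : ℕ) : ℕ :=
  -- The initial state absorbs zeros, so that the digit recursion for the state sequence also holds
  -- at `0 = k * 0 + 0`.
  if i = codeSize c ∧ d = 0 then i
  -- The minimum keeps the value a state number even if the table is ill-formed.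
  else min (codeSize c) ((c.2.2.1.getD (codeRow c i) []).getD d 0)

/-- The output function of the code `c`, with values `0` and `1`. -/
def codeOut (c : DFAOCode) (i : ℕ) : ℕ := (c.2.2.2.getD (codeRow c i) false).toNat

/-- The base of the code `c`. -/
def codeBase (c : DFAOCode) : ℕ := max c.1 2

/-- The number of digits that are read in one block. -/
def codeBlock (c : DFAOCode) : ℕ := (codeSize c + 1).factorial

/-- The transition function for blocks of digits. -/
def codeBlockStep (c : DFAOCode) : ℕ → ℕ → ℕ :=
  readDigits (codeStep c) (codeBase c) (codeBlock c)

section Primrec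

variable {A : Type*} [Primcodable A] {c : A → DFAOCode} {i d : A → ℕ}

theorem primrec_codeSize (hc : Primrec c) : Primrec fun a => codeSize (c a) :=
  Primrec.list_length.comp (Primrec.snd.comp (Primrec.snd.comp (Primrec.snd.comp hc)))

theorem primrec_codeRow (hc : Primrec c) (hi : Primrec i) :
    Primrec fun a => codeRow (c a) (i a) :=
  Primrec.ite (Primrec.eq.comp hi (primrec_codeSize hc))
    (Primrec.fst.comp (Primrec.snd.comp hc)) hi

theorem primrec_codeStep (hc : Primrec c) (hi : Primrec i) (hd : Primrec d) :
    Primrec fun a => codeStep (c a) (i a) (d a) :=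
  Primrec.ite
    ((Primrec.eq.comp hi (primrec_codeSize hc)).and (Primrec.eq.comp hd (Primrec.const 0))) hi
    (Primrec.nat_min.comp (primrec_codeSize hc)
      ((Primrec.list_getD 0).comp ((Primrec.list_getD []).comp
        (Primrec.fst.comp (Primrec.snd.comp (Primrec.snd.comp hc))) (primrec_codeRow hc hi)) hd))

theorem primrec_codeOut (hc : Primrec c) (hi : Primrec i) :
    Primrec fun a => codeOut (c a) (i a) :=
  (Primrec.dom_bool Bool.toNat).comp ((Primrec.list_getD false).comp
    (Primrec.snd.comp (Primrec.snd.comp (Primrec.snd.comp hc))) (primrec_codeRow hc hi))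

theorem primrec_codeBase (hc : Primrec c) : Primrec fun a => codeBase (c a) :=
  Primrec.nat_max.comp (Primrec.fst.comp hc) (Primrec.const 2)

theorem primrec_codeBlock (hc : Primrec c) : Primrec fun a => codeBlock (c a) :=
  primrec_factorial (Primrec.succ.comp (primrec_codeSize hc))

theorem primrec_codeBlockStep (hc : Primrec c) (hi : Primrec i) (hd : Primrec d) :
    Primrec fun a => codeBlockStep (c a) (i a) (d a) := by
  have hc' : Primrec fun x : A × (ℕ × ℕ) => c x.1 := hc.comp Primrec.fst
  refine (Primrec.nat_rec' (h := fun a p => codeStep (c a) p.2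
      (d a / codeBase (c a) ^ (codeBlock (c a) - (p.1 + 1)) % codeBase (c a)))
    (primrec_codeBlock hc) hi (primrec_codeStep hc' (Primrec.snd.comp Primrec.snd)
      (Primrec.nat_mod.comp (Primrec.nat_div.comp (hd.comp Primrec.fst)
        (primrec_pow (primrec_codeBase hc') (Primrec.nat_sub.comp (primrec_codeBlock hc')
          (Primrec.succ.comp (Primrec.fst.comp Primrec.snd))))) (primrec_codeBase hc')))).of_eq
    fun a => ?_
  exact readDigits_eq_rec _ _ _ _ _

end Primrec

/-- The data of a certificate: `Z`, `a`, `b`, and the tables of the functions `F`, `W`, `H`. -/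
abbrev CertificateData : Type := ℕ × ℕ × ℕ × List ℕ × List ℕ × List ℕ

namespace CertificateData

/-- The common denominator. -/
def Z (z : CertificateData) : ℕ := z.1
/-- The numerator of the density. -/
def a (z : CertificateData) : ℕ := z.2.1
/-- The denominator of the density. -/
def b (z : CertificateData) : ℕ := z.2.2.1
/-- The table of limit frequencies. -/
def F (z : CertificateData) (i : ℕ) : ℕ := z.2.2.2.1.getD i 0
/-- The table of the solution of the Poisson equation. -/
def W (z : CertificateData) (i : ℕ) : ℕ := z.2.2.2.2.1.getD i 0
/-- The table of the potential. -/
def H (z : CertificateData) (i : ℕ) : ℕ := z.2.2.2.2.2.getD i 0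

section Primrec

variable {A : Type*} [Primcodable A] {z : A → CertificateData} {i : A → ℕ}

theorem primrec_Z (hz : Primrec z) : Primrec fun x => (z x).Z := Primrec.fst.comp hz
theorem primrec_a (hz : Primrec z) : Primrec fun x => (z x).a :=
  Primrec.fst.comp (Primrec.snd.comp hz)
theorem primrec_b (hz : Primrec z) : Primrec fun x => (z x).b :=
  Primrec.fst.comp (Primrec.snd.comp (Primrec.snd.comp hz))
theorem primrec_F (hz : Primrec z) (hi : Primrec i) : Primrec fun x => (z x).F (i x) :=
  (Primrec.list_getD 0).comp
    (Primrec.fst.comp (Primrec.snd.comp (Primrec.snd.comp (Primrec.snd.comp hz)))) hi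
theorem primrec_W (hz : Primrec z) (hi : Primrec i) : Primrec fun x => (z x).W (i x) :=
  (Primrec.list_getD 0).comp
    (Primrec.fst.comp (Primrec.snd.comp (Primrec.snd.comp (Primrec.snd.comp
      (Primrec.snd.comp hz))))) hi
theorem primrec_H (hz : Primrec z) (hi : Primrec i) : Primrec fun x => (z x).H (i x) :=
  (Primrec.list_getD 0).comp
    (Primrec.snd.comp (Primrec.snd.comp (Primrec.snd.comp (Primrec.snd.comp
      (Primrec.snd.comp hz))))) hi

end Primrec

end CertificateData

/-- The left-hand side of the inequalities for the potential. -/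
def codeGain (c : DFAOCode) (z : CertificateData) (i d : ℕ) : ℕ :=
  z.b * ∑ e ∈ Finset.range d, z.F (codeBlockStep c i e) + z.H (codeBlockStep c i d)

/-- `z` is a certificate for the automaton with code `c`. -/
def CodeCertifies (c : DFAOCode) (z : CertificateData) : Prop :=
  (0 < z.Z ∧ 0 < z.b) ∧
  (∀ i < codeSize c + 1,
    codeBase c ^ codeBlock c * z.F i =
      ∑ d ∈ Finset.range (codeBase c ^ codeBlock c), z.F (codeBlockStep c i d)) ∧
  (∀ i < codeSize c + 1,
    codeBase c ^ codeBlock c * z.Z * codeOut c i +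
        ∑ d ∈ Finset.range (codeBase c ^ codeBlock c), z.W (codeBlockStep c i d) =
      codeBase c ^ codeBlock c * z.F i + codeBase c ^ codeBlock c * z.W i) ∧
  (∀ i < codeSize c + 1, ∀ d < codeBase c ^ codeBlock c,
    codeGain c z i d ≤ codeBase c ^ codeBlock c * z.H i + z.a * z.Z * d) ∧
  (∀ i < codeSize c + 1, ∃ d < codeBase c ^ codeBlock c,
    codeGain c z i d = codeBase c ^ codeBlock c * z.H i + z.a * z.Z * d) ∧
  -- The implication is written as a disjunction to match the closure properties of `PrimrecPred`.
  (∀ d < codeBase c ^ codeBlock c, ¬ 1 ≤ d ∨ codeGain c z (codeSize c) d ≤ z.a * z.Z * d) ∧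
  ∃ d < codeBase c ^ codeBlock c, 1 ≤ d ∧ codeGain c z (codeSize c) d = z.a * z.Z * d

section Primrec

variable {A : Type*} [Primcodable A] {c : A → DFAOCode} {z : A → CertificateData} {i d : A → ℕ}

open CertificateData

theorem primrec_codeGain (hc : Primrec c) (hz : Primrec z) (hi : Primrec i) (hd : Primrec d) :
    Primrec fun a => codeGain (c a) (z a) (i a) (d a) :=
  Primrec.nat_add.comp
    (Primrec.nat_mul.comp (primrec_b hz)
      (primrec_sum_range (f := fun a e => (z a).F (codeBlockStep (c a) (i a) e))
        (primrec_F (hz.comp Primrec.fst)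
          (primrec_codeBlockStep (hc.comp Primrec.fst) (hi.comp Primrec.fst) Primrec.snd)) hd))
    (primrec_H hz (primrec_codeBlockStep hc hi hd))

theorem primrec_codePow (hc : Primrec c) :
    Primrec fun a => codeBase (c a) ^ codeBlock (c a) :=
  primrec_pow (primrec_codeBase hc) (primrec_codeBlock hc)

theorem primrecPred_codeCertifies :
    PrimrecPred fun x : DFAOCode × CertificateData => CodeCertifies x.1 x.2 := by
  have hc := Primrec.fst (α := DFAOCode) (β := CertificateData)
  have hz := Primrec.snd (α := DFAOCode) (β := CertificateData)
  have hc1 := hc.comp (Primrec.fst (β := ℕ))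
  have hz1 := hz.comp (Primrec.fst (β := ℕ))
  have hi1 := Primrec.snd (α := DFAOCode × CertificateData) (β := ℕ)
  have hc2 := hc1.comp (Primrec.fst (β := ℕ))
  have hz2 := hz1.comp (Primrec.fst (β := ℕ))
  have hi2 := hi1.comp (Primrec.fst (β := ℕ))
  have hd2 := Primrec.snd (α := (DFAOCode × CertificateData) × ℕ) (β := ℕ)
  have hsize := Primrec.succ.comp (primrec_codeSize hc)
  have hlin1 : Primrec fun x : (DFAOCode × CertificateData) × ℕ => x.1.2.a * x.1.2.Z * x.2 :=
    Primrec.nat_mul.comp (Primrec.nat_mul.comp (primrec_a hz1) (primrec_Z hz1)) hi1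
  have hrhs2 : Primrec fun x : ((DFAOCode × CertificateData) × ℕ) × ℕ =>
      codeBase x.1.1.1 ^ codeBlock x.1.1.1 * x.1.1.2.H x.1.2 + x.1.1.2.a * x.1.1.2.Z * x.2 :=
    Primrec.nat_add.comp (Primrec.nat_mul.comp (primrec_codePow hc2) (primrec_H hz2 hi2))
      (Primrec.nat_mul.comp (Primrec.nat_mul.comp (primrec_a hz2) (primrec_Z hz2)) hd2)
  have hgain1 := primrec_codeGain hc1 hz1 (primrec_codeSize hc1) hi1
  have hgain2 := primrec_codeGain hc2 hz2 hi2 hd2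
  have hone := Primrec.nat_le.comp (Primrec.const 1) hi1
  refine PrimrecPred.and (PrimrecPred.and (Primrec.nat_lt.comp (Primrec.const 0) (primrec_Z hz))
    (Primrec.nat_lt.comp (Primrec.const 0) (primrec_b hz))) <|
    PrimrecPred.and (primrecPred_forall_lt ?_ hsize) <|
    PrimrecPred.and (primrecPred_forall_lt ?_ hsize) <|
    PrimrecPred.and (primrecPred_forall_lt (primrecPred_forall_lt
      (Primrec.nat_le.comp hgain2 hrhs2) (primrec_codePow hc1)) hsize) <|
    PrimrecPred.and (primrecPred_forall_lt (primrecPred_exists_lt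
      (Primrec.eq.comp hgain2 hrhs2) (primrec_codePow hc1)) hsize) <|
    PrimrecPred.and (primrecPred_forall_lt
      (hone.not.or (Primrec.nat_le.comp hgain1 hlin1)) (primrec_codePow hc)) <|
    primrecPred_exists_lt (hone.and (Primrec.eq.comp hgain1 hlin1)) (primrec_codePow hc)
  · exact Primrec.eq.comp (Primrec.nat_mul.comp (primrec_codePow hc1) (primrec_F hz1 hi1))
      (primrec_sum_range (primrec_F hz2 (primrec_codeBlockStep hc2 hi2 hd2))
        (primrec_codePow hc1))
  · exact Primrec.eq.comp
      (Primrec.nat_add.comp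
        (Primrec.nat_mul.comp (Primrec.nat_mul.comp (primrec_codePow hc1) (primrec_Z hz1))
          (primrec_codeOut hc1 hi1))
        (primrec_sum_range (primrec_W hz2 (primrec_codeBlockStep hc2 hi2 hd2))
          (primrec_codePow hc1)))
      (Primrec.nat_add.comp (Primrec.nat_mul.comp (primrec_codePow hc1) (primrec_F hz1 hi1))
        (Primrec.nat_mul.comp (primrec_codePow hc1) (primrec_W hz1 hi1)))

end Primrec

/-! ### State sequences of coded automata. -/

/-- The transition function of the code `c` on its finite set of states. -/
def finStep (c : DFAOCode) (i : Fin (codeSize c + 1)) (d : ℕ) : Fin (codeSize c + 1) :=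
  ⟨codeStep c i d, by
    have := i.2
    unfold codeStep
    split_ifs <;> omega⟩

theorem readDigits_finStep (c : DFAOCode) (k t : ℕ) (i : Fin (codeSize c + 1)) (n : ℕ) :
    (readDigits (finStep c) k t i n).val = readDigits (codeStep c) k t i n := by
  induction t generalizing n with
  | zero => rfl
  | succ t ih => rw [readDigits, readDigits, ← ih]; rfl

theorem codeCertifies_iff (c : DFAOCode) (z : CertificateData) :
    CodeCertifies c z ↔ IsCertificate (σ := Fin (codeSize c + 1)) (readDigits (finStep c) (codeBase c) (codeBlock c))
      (codeBase c ^ codeBlock c) (Fin.last (codeSize c)) (fun i => codeOut c i) z.Z z.a z.b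
      (fun i => z.F i) (fun i => z.W i) (fun i => z.H i) := by
  constructor
  · rintro ⟨h1, h2, h3, h4, h5, h6, h7⟩
    refine ⟨h1, fun i => ?_, fun i => ?_, fun i => ?_, fun i => ?_, fun d hd hd' => ?_, ?_⟩ <;>
      simp only [readDigits_finStep]
    · exact h2 i i.2
    · exact h3 i i.2
    · exact h4 i i.2
    · exact h5 i i.2
    · exact (h6 d hd).resolve_left (not_not.2 hd')
    · exact h7
  · rintro ⟨h1, h2, h3, h4, h5, h6, h7⟩
    simp only [readDigits_finStep] at h2 h3 h4 h5 h6 h7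
    exact ⟨h1, fun i hi => h2 ⟨i, hi⟩, fun i hi => h3 ⟨i, hi⟩, fun i hi => h4 ⟨i, hi⟩,
      fun i hi => h5 ⟨i, hi⟩, fun d hd => or_iff_not_imp_left.2 fun h => h6 d hd (not_not.1 h), h7⟩

/-- The state that is reached from `s` after reading the base-`k` expansion of `n`. -/
def stateSeq {σ : Type*} (δ : σ → ℕ → σ) (s : σ) (k n : ℕ) : σ :=
  (Nat.digits k n).foldr (fun d i => δ i d) s

theorem stateSeq_zero {σ : Type*} (δ : σ → ℕ → σ) (s : σ) (k : ℕ) : stateSeq δ s k 0 = s := by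
  simp [stateSeq]

/-- The expansion of 0 is empty, so at `N = d = 0` the right-hand side reads a leading zero that the
left-hand side does not; this is harmless only if that zero fixes `s`. -/
theorem stateSeq_mul_add {σ : Type*} {δ : σ → ℕ → σ} {s : σ} {k : ℕ} (hk : 2 ≤ k) {N d : ℕ}
    (hd : d < k) (h : δ s 0 = s ∨ k * N + d ≠ 0) :
    stateSeq δ s k (k * N + d) = δ (stateSeq δ s k N) d := by
  by_cases h0 : k * N + d = 0
  · have hN : N = 0 := by
      rcases Nat.eq_zero_or_pos N with h | h
      · exact h
      · nlinarith
    obtain rfl : d = 0 := by omega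
    subst hN
    simpa [stateSeq] using (h.resolve_right (by simp)).symm
  · have : k * N + d = d + k * N := add_comm _ _
    rw [stateSeq, this, Nat.digits_add k hk d N hd (by by_contra! hc; simp_all)]
    rfl

theorem state_pow_mul_add {σ : Type*} {δ : σ → ℕ → σ} {k : ℕ} (hk : 0 < k) {q : ℕ → σ}
    (hq : ∀ N, ∀ d < k, q (k * N + d) = δ (q N) d) (p : ℕ) (N : ℕ) :
    ∀ d < k ^ p, q (k ^ p * N + d) = readDigits δ k p (q N) d := by
  induction p with
  | zero =>
    intro d hd
    obtain rfl : d = 0 := by simpa using hd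
    simp [readDigits]
  | succ p ih =>
    intro d hd
    have h1 : k ^ (p + 1) * N + d = k * (k ^ p * N + d / k) + d % k := by
      rw [mul_add, add_assoc, Nat.div_add_mod, pow_succ']
      ring
    rw [h1, hq _ _ (Nat.mod_lt _ hk), ih _ (by
      rw [Nat.div_lt_iff_lt_mul hk, ← pow_succ]; exact hd), readDigits]

/-- The sequence of states of the automaton with code `c`. -/
def codeState (c : DFAOCode) : ℕ → Fin (codeSize c + 1) :=
  stateSeq (finStep c) (Fin.last (codeSize c)) (codeBase c)

theorem two_le_codeBase (c : DFAOCode) : 2 ≤ codeBase c := le_max_right _ _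

theorem two_le_codePow (c : DFAOCode) : 2 ≤ codeBase c ^ codeBlock c :=
  (two_le_codeBase c).trans
    (Nat.le_self_pow (Nat.factorial_ne_zero _) _)

theorem codeState_zero (c : DFAOCode) : codeState c 0 = Fin.last (codeSize c) :=
  stateSeq_zero _ _ _

theorem codeState_mul_add (c : DFAOCode) (N : ℕ) :
    ∀ d < codeBase c, codeState c (codeBase c * N + d) = finStep c (codeState c N) d :=
  fun _ hd => stateSeq_mul_add (two_le_codeBase c) hd
    (Or.inl (Fin.ext (by simp [finStep, codeStep])))

theorem codeState_pow_mul_add (c : DFAOCode) (N : ℕ) :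
    ∀ d < codeBase c ^ codeBlock c, codeState c (codeBase c ^ codeBlock c * N + d) =
      readDigits (finStep c) (codeBase c) (codeBlock c) (codeState c N) d :=
  state_pow_mul_add (by have := two_le_codeBase c; omega) (codeState_mul_add c) _ N

/-- The block length is the factorial of the number of states, the additional one included, as
`tendsto_avgOp_pow_sub` requires. -/
theorem tendsto_avgOp_code (c : DFAOCode) (w : Fin (codeSize c + 1) → ℂ) :
    Tendsto (fun n =>
      (avgOp ℂ (readDigits (finStep c) (codeBase c) (codeBlock c))
        (codeBase c ^ codeBlock c) ^ n)
      (w - avgOp ℂ (readDigits (finStep c) (codeBase c) (codeBlock c))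
        (codeBase c ^ codeBlock c) w)) atTop (𝓝 0) := by
  rw [avgOp_readDigits]
  have hk : codeBase c ≠ 0 := by have := two_le_codeBase c; omega
  have h := tendsto_avgOp_pow_sub (finStep c) hk w
  rw [Fintype.card_fin] at h
  exact h

theorem getD_ofFn {α : Type*} {n : ℕ} (F : Fin n → α) (i : Fin n) (a : α) :
    (List.ofFn F).getD i a = F i := by
  rw [List.getD_eq_getElem _ _ (by simp)]
  simp

/-- The default values in `codeStep`, `codeOut` and `codeBase` turn every code, even an ill-formed
one, into an automaton. Hence the search below is total. -/
theorem exists_codeCertifies (c : DFAOCode) : ∃ z, CodeCertifies c z := by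
  obtain ⟨Z, a, b, F, W, H, h⟩ := exists_isCertificate (two_le_codePow c)
    (codeState_pow_mul_add c) (fun i => codeOut c i) (tendsto_avgOp_code c)
  rw [codeState_zero] at h
  refine ⟨(Z, a, b, List.ofFn F, List.ofFn W, List.ofFn H), (codeCertifies_iff _ _).2 ?_⟩
  simpa only [CertificateData.Z, CertificateData.a, CertificateData.b, CertificateData.F,
    CertificateData.W, CertificateData.H, getD_ofFn] using h

/-! ### Computing the density by search. -/

open Classical in
/-- The result of the test whether `n` encodes a certificate for `c`. -/
noncomputable def certificateAt (c : DFAOCode) (n : ℕ) : Option (ℕ × ℕ) :=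
  (Encodable.decode (α := CertificateData) n).bind fun z =>
    if CodeCertifies c z then some (z.a, z.b) else none

theorem computable_certificateAt : Computable₂ certificateAt := by
  classical
  refine Primrec.to_comp ?_
  have hz := Primrec.snd (α := DFAOCode × ℕ) (β := CertificateData)
  exact Primrec.option_bind (Primrec.decode.comp Primrec.snd)
    (Primrec.ite (primrecPred_codeCertifies.comp
      ((Primrec.fst.comp Primrec.fst).pair hz))
      (Primrec.option_some.comp ((CertificateData.primrec_a hz).pair
        (CertificateData.primrec_b hz))) (Primrec.const none))

theorem rfindOpt_certificateAt_dom (c : DFAOCode) : (Nat.rfindOpt (certificateAt c)).Dom := by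
  obtain ⟨z, hz⟩ := exists_codeCertifies c
  exact Nat.rfindOpt_dom.2 ⟨Encodable.encode z, (z.a, z.b), by
    rw [certificateAt, Encodable.encodek, Option.bind_some, if_pos hz]
    rfl⟩

/-- The upper density of the set with code `c`, as a numerator and a denominator. -/
noncomputable def codeDensity (c : DFAOCode) : ℕ × ℕ :=
  (Nat.rfindOpt (certificateAt c)).get (rfindOpt_certificateAt_dom c)

theorem computable_codeDensity : Computable codeDensity :=
  (Partrec.rfindOpt computable_certificateAt).of_eq fun _ => (Part.some_get _).symm

/-- Certificates need not be unique, but by soundness whichever one the search meets has the right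
quotient. -/
theorem codeDensity_spec (c : DFAOCode) : (codeDensity c).2 ≠ 0 ∧
    limsup (fun n : ℕ => (∑ j ∈ Finset.range n, (codeOut c (codeState c j) : ℝ)) / (n : ℝ)) atTop =
      ((codeDensity c).1 : ℝ) / (codeDensity c).2 := by
  obtain ⟨n, hn⟩ := Nat.rfindOpt_spec (Part.get_mem (rfindOpt_certificateAt_dom c))
  change codeDensity c ∈ certificateAt c n at hn
  rw [certificateAt, Option.mem_def, Option.bind_eq_some_iff] at hn
  obtain ⟨z, -, hz⟩ := hn
  split_ifs at hz with hcert
  rw [← Option.some.inj hz]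
  refine ⟨hcert.1.2.ne', ?_⟩
  have h := (codeCertifies_iff _ _).1 hcert
  rw [← codeState_zero] at h
  exact IsCertificate.limsup_eq (q := codeState c) (v := fun i => codeOut c i)
    (two_le_codePow c) (codeState_pow_mul_add c) h (tendsto_avgOp_code c)

/-! ### Comparison of an automaton with its code. -/

/-- The transition function of an automaton over `Fin k`, with natural numbers as digits. -/
def natStep {k : ℕ} {σ Δ : Type*} (M : DFAO (Fin k) σ Δ) (i : σ) (d : ℕ) : σ :=
  if h : d < k then M.step i ⟨d, h⟩ else i

theorem eval_baseExpansion {k : ℕ} (hk : 2 ≤ k) {σ Δ : Type*} (M : DFAO (Fin k) σ Δ) (n : ℕ) :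
    M.eval (baseExpansion k hk n) = M.out (stateSeq (natStep M) M.start k n) := by
  rw [DFAO.eval, baseExpansion, List.foldl_reverse, List.foldr_map, stateSeq]
  conv_rhs => rw [← List.foldr_attach]
  congr 2
  ext d i
  simp [natStep, Nat.digits_lt_base hk d.2]

section Code

variable {k m : ℕ} {σ : Type*} (M : DFAO (Fin k) σ Bool) (e : Fin m ≃ σ)

theorem codeSize_code : codeSize (M.code e) = m := by
  simp [codeSize, DFAO.code]

theorem codeBase_code (hk : 2 ≤ k) : codeBase (M.code e) = k := max_eq_left hk

/-- A state that uses the row of `x` moves as `M` does in the state `x`. -/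
theorem codeStep_code {i : ℕ} (x : σ) (hi : codeRow (M.code e) i = (e.symm x : ℕ)) {d : ℕ}
    (hd : d < k) (h : i ≠ m ∨ d ≠ 0) :
    codeStep (M.code e) i d = (e.symm (natStep M x d) : ℕ) := by
  rw [codeStep, codeSize_code, if_neg (by tauto), hi]
  have h1 : (M.code e).2.2.1.getD (e.symm x : ℕ) [] =
      List.ofFn (fun d : Fin k => (e.symm (M.step x d) : ℕ)) := by
    simp only [DFAO.code, getD_ofFn, Equiv.apply_symm_apply]
  have h2 := getD_ofFn (fun d : Fin k => (e.symm (M.step x d) : ℕ)) ⟨d, hd⟩ 0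
  rw [h1, h2, natStep, dif_pos hd]
  exact min_eq_right (Fin.is_lt _).le

theorem codeRow_last : codeRow (M.code e) m = (e.symm M.start : ℕ) := by
  rw [codeRow, codeSize_code, if_pos rfl]
  rfl

theorem codeRow_of_lt (i : Fin m) : codeRow (M.code e) i = i := by
  rw [codeRow, codeSize_code, if_neg i.2.ne]

/-- The two runs differ only at `n = 0`, where the code is in its additional state. The first
nonzero digit leaves that state through the row of `M.start`. -/
theorem codeState_code (hk : 2 ≤ k) {n : ℕ} (hn : n ≠ 0) :
    (codeState (M.code e) n : ℕ) = (e.symm (stateSeq (natStep M) M.start k n) : ℕ) := by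
  induction n using Nat.strong_induction_on with
  | _ n ih =>
    have hd : n % k < k := Nat.mod_lt _ (by omega)
    have h1 := codeState_mul_add (M.code e) (n / k) (n % k) (by rwa [codeBase_code M e hk])
    rw [codeBase_code M e hk, Nat.div_add_mod] at h1
    have h2 := stateSeq_mul_add (δ := natStep M) (s := M.start) (N := n / k) hk hd
      (Or.inr (by rwa [Nat.div_add_mod]))
    rw [Nat.div_add_mod] at h2
    rw [h1, h2]
    change codeStep _ _ _ = _
    by_cases h0 : n / k = 0
    · have h3 : n % k ≠ 0 := fun h => hn (by rw [← Nat.div_add_mod n k, h0, h]; simp)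
      rw [h0, codeState_zero, Fin.val_last, stateSeq_zero]
      refine codeStep_code M e _ ?_ hd (Or.inr h3)
      rw [codeSize_code, codeRow_last]
    · have h3 := ih (n / k) (Nat.div_lt_self (by omega) (by omega)) h0
      rw [h3]
      exact codeStep_code M e _ (codeRow_of_lt M e _) hd (Or.inl (Fin.is_lt _).ne)

theorem codeOut_codeState (hk : 2 ≤ k) (n : ℕ) :
    codeOut (M.code e) (codeState (M.code e) n) =
      (M.eval (baseExpansion k hk n)).toNat := by
  have key : codeRow (M.code e) (codeState (M.code e) n) =
      (e.symm (stateSeq (natStep M) M.start k n) : ℕ) := by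
    by_cases hn : n = 0
    · rw [hn, codeState_zero, Fin.val_last, codeSize_code, codeRow_last, stateSeq_zero]
    · rw [codeState_code M e hk hn, codeRow_of_lt]
  rw [codeOut, key, eval_baseExpansion]
  simp only [DFAO.code, getD_ofFn, Equiv.apply_symm_apply]

end Code

/-! ### Densities, complements and the conclusion. -/

open Classical in
theorem countBelow_eq_sum (S : Set ℕ) (n : ℕ) :
    countBelow S n = ∑ j ∈ Finset.range n, (charSeq S j).toNat := by
  have h : S ∩ Set.Iio n = ((Finset.range n).filter (· ∈ S) : Finset ℕ) := by
    ext j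
    simp [and_comm]
  rw [countBelow, h, Set.ncard_coe_finset, Finset.card_filter]
  refine Finset.sum_congr rfl fun j _ => ?_
  by_cases hj : j ∈ S <;> simp [charSeq, hj]

theorem upperDensity_eq_codeDensity {k m : ℕ} (hk : 2 ≤ k) {S : Set ℕ} {σ : Type*}
    (M : DFAO (Fin k) σ Bool) (e : Fin m ≃ σ) (hM : M.Generates hk (charSeq S)) :
    upperDensity S = ((codeDensity (M.code e)).1 : ℝ) / (codeDensity (M.code e)).2 := by
  rw [← (codeDensity_spec (M.code e)).2, upperDensity]
  simp only [codeOut_codeState M e hk, hM _, countBelow_eq_sum, Nat.cast_sum]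

theorem countBelow_le (S : Set ℕ) (n : ℕ) : countBelow S n ≤ n := by
  rw [countBelow_eq_sum]
  refine (Finset.sum_le_card_nsmul _ _ 1 fun j _ => Bool.toNat_le _).trans ?_
  simp

theorem countBelow_add_compl (S : Set ℕ) (n : ℕ) : countBelow S n + countBelow Sᶜ n = n := by
  rw [countBelow_eq_sum, countBelow_eq_sum, ← Finset.sum_add_distrib]
  have : ∀ j, (charSeq S j).toNat + (charSeq Sᶜ j).toNat = 1 := fun j => by
    by_cases hj : j ∈ S <;> simp [charSeq, hj]
  simp [this]

theorem countBelow_div_mem (S : Set ℕ) (n : ℕ) :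
    0 ≤ (countBelow S n : ℝ) / n ∧ (countBelow S n : ℝ) / n ≤ 1 :=
  ⟨by positivity, div_le_one_of_le₀ (by exact_mod_cast countBelow_le S n) (by positivity)⟩

theorem isBoundedUnder_countBelow (S : Set ℕ) :
    IsBoundedUnder (· ≤ ·) atTop (fun n : ℕ => (countBelow S n : ℝ) / n) :=
  isBoundedUnder_of ⟨1, fun n => (countBelow_div_mem S n).2⟩

theorem isCoboundedUnder_countBelow (S : Set ℕ) :
    IsCoboundedUnder (· ≤ ·) atTop (fun n : ℕ => (countBelow S n : ℝ) / n) :=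
  (isBoundedUnder_of ⟨0, fun n => (countBelow_div_mem S n).1⟩ :
    IsBoundedUnder (· ≥ ·) atTop _).isCoboundedUnder_le

theorem upperDensity_le_one (S : Set ℕ) : upperDensity S ≤ 1 :=
  limsup_le_of_le (isCoboundedUnder_countBelow S)
    (Eventually.of_forall fun n => (countBelow_div_mem S n).2)

theorem lowerDensity_eq (S : Set ℕ) : lowerDensity S = 1 - upperDensity Sᶜ := by
  have h : liminf (fun n : ℕ => 1 - (countBelow Sᶜ n : ℝ) / n) atTop =
      1 - limsup (fun n : ℕ => (countBelow Sᶜ n : ℝ) / n) atTop := by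
    have hanti : Antitone fun x : ℝ => 1 - x := fun x y h => sub_le_sub_left h 1
    exact (hanti.map_limsup_of_continuousAt _ (continuous_const.sub continuous_id).continuousAt
      (isBoundedUnder_countBelow _) (isCoboundedUnder_countBelow _)).symm
  rw [upperDensity, ← h, lowerDensity]
  refine liminf_congr ?_
  -- At `n = 0` both quotients are 0, so complementarity holds only for positive `n`.
  filter_upwards [eventually_gt_atTop 0] with n hn
  have hn' : (n : ℝ) ≠ 0 := by positivity
  have h2 : (countBelow S n : ℝ) + countBelow Sᶜ n = n := by
    exact_mod_cast countBelow_add_compl S n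
  field_simp
  linarith

/-- The automaton with complemented outputs. -/
def complement {k : ℕ} {σ : Type*} (M : DFAO (Fin k) σ Bool) : DFAO (Fin k) σ Bool :=
  ⟨M.step, M.start, fun i => !M.out i⟩

/-- The code of the automaton with complemented outputs. -/
def complementCode (c : DFAOCode) : DFAOCode := (c.1, c.2.1, c.2.2.1, c.2.2.2.map (!·))

theorem primrec_complementCode : Primrec complementCode :=
  Primrec.fst.pair ((Primrec.fst.comp Primrec.snd).pair
    ((Primrec.fst.comp (Primrec.snd.comp Primrec.snd)).pair
      (Primrec.list_map (Primrec.snd.comp (Primrec.snd.comp Primrec.snd))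
        (Primrec.not.comp Primrec.snd))))

theorem code_complement {k m : ℕ} {σ : Type*} (M : DFAO (Fin k) σ Bool) (e : Fin m ≃ σ) :
    (complement M).code e = complementCode (M.code e) := by
  simp [complementCode, DFAO.code, complement, List.map_ofFn, Function.comp_def]

theorem complement_generates {k : ℕ} (hk : 2 ≤ k) {S : Set ℕ} {σ : Type*}
    {M : DFAO (Fin k) σ Bool} (hM : M.Generates hk (charSeq S)) :
    (complement M).Generates hk (charSeq Sᶜ) := fun n => by
  have h := hM n
  rw [eval_baseExpansion] at h ⊢
  change (!M.out (stateSeq (natStep M) M.start k n)) = _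
  rw [h]
  by_cases hn : n ∈ S <;> simp [charSeq, hn]

/-- The lower density of the set with code `c`, as a numerator and a denominator. -/
noncomputable def codeLowerDensity (c : DFAOCode) : ℕ × ℕ :=
  ((codeDensity (complementCode c)).2 - (codeDensity (complementCode c)).1,
    (codeDensity (complementCode c)).2)

theorem computable_codeLowerDensity : Computable codeLowerDensity := by
  have h := computable_codeDensity.comp primrec_complementCode.to_comp
  exact (Primrec.nat_sub.to_comp.comp (Computable.snd.comp h) (Computable.fst.comp h)).pair
    (Computable.snd.comp h)

theorem lowerDensity_eq_codeLowerDensity {k m : ℕ} (hk : 2 ≤ k) {S : Set ℕ} {σ : Type*}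
    (M : DFAO (Fin k) σ Bool) (e : Fin m ≃ σ) (hM : M.Generates hk (charSeq S)) :
    (codeLowerDensity (M.code e)).2 ≠ 0 ∧ lowerDensity S =
      ((codeLowerDensity (M.code e)).1 : ℝ) / (codeLowerDensity (M.code e)).2 := by
  have h := upperDensity_eq_codeDensity hk (complement M) e (complement_generates hk hM)
  have h0 := (codeDensity_spec ((complement M).code e)).1
  rw [code_complement] at h h0
  rw [codeLowerDensity, lowerDensity_eq, h]
  -- This makes the truncated subtraction in `codeLowerDensity` a true one.
  have h1 := upperDensity_le_one Sᶜ
  rw [h] at h1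
  generalize codeDensity (complementCode (M.code e)) = u at h0 h1 ⊢
  have hpos : (0 : ℝ) < u.2 := Nat.cast_pos.2 (Nat.pos_of_ne_zero h0)
  rw [div_le_one hpos] at h1
  exact ⟨h0, by rw [Nat.cast_sub (by exact_mod_cast h1), sub_div, div_self hpos.ne']⟩

end AutomaticDensity

theorem corollary1p2 :
    -- two algorithms that turn a description of an automaton into a numerator and a denominator
    ∃ U L : DFAOCode → ℕ × ℕ, Computable U ∧ Computable L ∧
      ∀ (k : ℕ) (hk : 2 ≤ k) (S : Set ℕ), IsAutomaticSet k hk S →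
        ∃ α β : ℚ,
          upperDensity S = (α : ℝ) ∧ lowerDensity S = (β : ℝ) ∧
          lowerDensity S = 1 - upperDensity Sᶜ ∧
          ∀ (σ : Type) (m : ℕ) (e : Fin m ≃ σ) (M : DFAO (Fin k) σ Bool),
            M.Generates hk (charSeq S) →
              ((U (M.code e)).2 ≠ 0 ∧ α = ((U (M.code e)).1 : ℚ) / ((U (M.code e)).2 : ℚ)) ∧
              ((L (M.code e)).2 ≠ 0 ∧ β = ((L (M.code e)).1 : ℚ) / ((L (M.code e)).2 : ℚ)) := by
  open AutomaticDensity in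
  refine ⟨codeDensity, codeLowerDensity, computable_codeDensity, computable_codeLowerDensity, ?_⟩
  rintro k hk S ⟨σ₀, hfin, M₀, hM₀⟩
  obtain ⟨m₀, ⟨e₀⟩⟩ := Finite.exists_equiv_fin σ₀
  have hα := upperDensity_eq_codeDensity hk M₀ e₀.symm hM₀
  have hβ := (lowerDensity_eq_codeLowerDensity hk M₀ e₀.symm hM₀).2
  refine ⟨(codeDensity (M₀.code e₀.symm)).1 / (codeDensity (M₀.code e₀.symm)).2,
    (codeLowerDensity (M₀.code e₀.symm)).1 / (codeLowerDensity (M₀.code e₀.symm)).2,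
    by rw [hα]; push_cast; rfl, by rw [hβ]; push_cast; rfl, lowerDensity_eq S, ?_⟩
  -- `α` and `β` come from one automaton. Any other automaton generating `S` gives the same
  -- quotients, because both pairs represent the density of `S`.
  intro σ m e M hM
  have h1 := upperDensity_eq_codeDensity hk M e hM
  obtain ⟨h2, h3⟩ := lowerDensity_eq_codeLowerDensity hk M e hM
  rw [hα] at h1
  rw [hβ] at h3
  exact ⟨⟨(codeDensity_spec _).1, Rat.cast_injective (α := ℝ) (by push_cast; exact h1)⟩, h2,
    Rat.cast_injective (α := ℝ) (by push_cast; exact h3)⟩
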